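/- A Frölicher space is a set $X$ with a set $\mathcal C_X$ of curves $\mathbb R\to X$ and a set $\mathcal F_X$ of functions $X\to\mathbb R$ such that $\mathcal F_X=\{f : f\circ c\in C^\infty(\mathbb R)\ \forall c\in\mathcal C_X\}$ and $\mathcal C_X=\{c : f\circ c\in C^\infty(\mathbb R)\ \forall f\in\mathcal F_X\}$; the structure generated by a set $F_0$ of functions has as curves all $c$ with $f\circ c\in C^\infty(\mathbb R)$ for all $f\in F_0$. A map $\varphi:X\to Y$ is smooth if $f\circ\varphi\in\mathcal F_X$ for all $f\in\mathcal F_Y$. Subspaces and products carry the initial structure, coproducts and quotients the final structure. Let $I=[0,1]$ be the unit interval as a subspace of $\mathbb R$, and let $\mathbf I$ be the flattened unit interval: the set $[0,1]$ with the structure generated by those $f\in\mathcal F_I$ for which there is $0<\epsilon<\frac14$ with $f=f(0)$ on $[0,\epsilon)$ and $f=f(1)$ on $(1-\epsilon,1]$. Work in the category of pointed Frölicher spaces and basepoint preserving smooth maps. A homotopy between pointed maps $X\to Y$ is a smooth map $H:I\times X\to Y$ with $H(t,x_0)=y_0$ for all $t$; $[X,W]$ is the set of homotopy classes of pointed maps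 $X\to W$, pointed by the class of the constant map. The smash product $X\wedge Y$ is $X\times Y$ with $(\{x_0\}\times Y)\cup(X\times\{y_0\})$ identified to a point, the basepoint. The reduced flattened suspension is $\Sigma X=(\mathbf I/\{0,1\})\wedge X$. For a pointed map $i:A\to X$ with basepoint $a_0$ of $A$, the flattened mapping cone $\mathbf T_i$ is the quotient of $(\mathbf I\times A)\sqcup X$ in which $(1,a)$ is identified with $i(a)$ for each $a\in A$, and $(\{0\}\times A)\cup(\mathbf I\times\{a_0\})$ is identified to a point, the basepoint. Let $j:X\to\mathbf T_i$, $x\mapsto[x]$, be the inclusion and $k:\mathbf T_i\to\Sigma A$, $[t,a]\mapsto t\wedge a$, $[x]\mapsto *$, the quotient map. For $0<\epsilon<\frac12$ a braking function $\alpha_\epsilon:\mathbb R\to\mathbb R$ is a smooth function that is $0$ on $(-\infty,\epsilon]$, strictly increasing with values in $(0,1)$ on $(\epsilon,1-\epsilon)$, and $1$ on $[1-\epsilon,\infty)$. An injective pointed smooth map $i:A\to X$ is a cofibration if for every pointed $Z$, every pointed smooth map $f:X\to Z$ and every pointed homotopy $G:I\times A\to Z$ with $G(0,a)=f(i(a))$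 for all $a\in A$, there are a braking function $\alpha_\epsilon$ for some $0<\epsilon<\frac12$ and a pointed homotopy $F:I\times X\to Z$ with $F(0,x)=f(x)$ for all $x\in X$ and $F(t,i(a))=G(\alpha_\epsilon(t),a)$ for all $t\in I$, $a\in A$. **Theorem.** Let $i:A\to X$ be a cofibration of pointed Frölicher spaces and let $W$ be a pointed Frölicher space. Then the sequence of pointed sets $$\cdots\to[\Sigma^{n+1}A,W]\xrightarrow{(\Sigma^nk)^*}[\Sigma^n\mathbf T_i,W]\xrightarrow{(\Sigma^nj)^*}[\Sigma^nX,W]\xrightarrow{(\Sigma^ni)^*}[\Sigma^nA,W]\to\cdots\to[\Sigma A,W]\xrightarrow{k^*}[\mathbf T_i,W]\xrightarrow{j^*}[X,W]\xrightarrow{i^*}[A,W]$$ is exact: at each of its terms other than the last term $[A,W]$, the image of the incoming map is the preimage of the basepoint under the outgoing map. That is, for every $n\ge 0$ it is exact at $[\Sigma^nX,W]$, at $[\Sigma^n\mathbf T_i,W]$ and at $[\Sigma^{n+1}A,W]$. -/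

import Mathlib

open scoped ContDiff

universe u v w

/-- A Frölicher structure on `X`: a set of curves and a set of functions that determine each
other through smoothness of the composites `ℝ → X → ℝ`. -/
class FrolicherSpace (X : Type u) where
  curves : Set (ℝ → X)
  functions : Set (X → ℝ)
  mem_functions_iff : ∀ f : X → ℝ, f ∈ functions ↔ ∀ c ∈ curves, ContDiff ℝ ∞ (f ∘ c)
  mem_curves_iff : ∀ c : ℝ → X, c ∈ curves ↔ ∀ f ∈ functions, ContDiff ℝ ∞ (f ∘ c)

namespace FrolicherSpace

/-- The structure generated by a set `F₀` of functions: curves `Γ F₀`, functions `Φ Γ F₀`. -/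
@[reducible]
def ofFunctions {X : Type u} (F₀ : Set (X → ℝ)) : FrolicherSpace X where
  curves := {c | ∀ f ∈ F₀, ContDiff ℝ ∞ (f ∘ c)}
  functions := {f | ∀ c : ℝ → X, (∀ g ∈ F₀, ContDiff ℝ ∞ (g ∘ c)) → ContDiff ℝ ∞ (f ∘ c)}
  mem_functions_iff _ := Iff.rfl
  mem_curves_iff c := ⟨fun hc _ hf => hf c hc, fun h g hg => h g fun _ hc => hc g hg⟩

/-- The structure generated by a set `C₀` of curves: functions `Φ C₀`, curves `Γ Φ C₀`. -/
@[reducible]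
def ofCurves {X : Type u} (C₀ : Set (ℝ → X)) : FrolicherSpace X where
  functions := {f | ∀ c ∈ C₀, ContDiff ℝ ∞ (f ∘ c)}
  curves := {c | ∀ f : X → ℝ, (∀ d ∈ C₀, ContDiff ℝ ∞ (f ∘ d)) → ContDiff ℝ ∞ (f ∘ c)}
  mem_functions_iff f := ⟨fun hf _ hc => hc f hf, fun h c hc => h c fun _ hf => hf c hc⟩
  mem_curves_iff _ := Iff.rfl

/-- The initial structure along one map. -/
@[reducible]
def induced {X : Type u} {Y : Type v} [FrolicherSpace Y] (φ : X → Y) : FrolicherSpace X :=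
  ofFunctions {f | ∃ g ∈ functions (X := Y), f = g ∘ φ}

/-- The final structure along one map. -/
@[reducible]
def coinduced {X : Type u} {Y : Type v} [FrolicherSpace X] (φ : X → Y) : FrolicherSpace Y :=
  ofCurves {d | ∃ c ∈ curves (X := X), d = φ ∘ c}

/-- The standard structure of the real line. -/
instance instReal : FrolicherSpace ℝ where
  curves := {c | ContDiff ℝ ∞ c}
  functions := {f | ContDiff ℝ ∞ f}
  mem_functions_iff _ := ⟨fun hf _ hc => ContDiff.comp hf hc, fun h => h id (contDiff_id (𝕜 := ℝ) (E := ℝ) (n := ∞))⟩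
  mem_curves_iff _ := ⟨fun hc _ hf => ContDiff.comp hf hc, fun h => h id (contDiff_id (𝕜 := ℝ) (E := ℝ) (n := ∞))⟩

/-- The usual unit interval, as a subspace of the real line. -/
instance instUnitInterval : FrolicherSpace unitInterval := induced (Subtype.val : unitInterval → ℝ)

/-- The product structure. -/
instance instProd {X : Type u} {Y : Type v} [FrolicherSpace X] [FrolicherSpace Y] :
    FrolicherSpace (X × Y) :=
  ofFunctions ({f | ∃ g ∈ functions (X := X), f = g ∘ Prod.fst} ∪
    {f | ∃ g ∈ functions (X := Y), f = g ∘ Prod.snd})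

/-- The coproduct structure. -/
instance instSum {X : Type u} {Y : Type v} [FrolicherSpace X] [FrolicherSpace Y] :
    FrolicherSpace (X ⊕ Y) :=
  ofCurves ({d | ∃ c ∈ curves (X := X), d = Sum.inl ∘ c} ∪
    {d | ∃ c ∈ curves (X := Y), d = Sum.inr ∘ c})

/-- A quotient carries the final structure along the quotient map. -/
instance instQuot {X : Type u} [FrolicherSpace X] (r : X → X → Prop) : FrolicherSpace (Quot r) :=
  coinduced (Quot.mk r)

end FrolicherSpace

open FrolicherSpace

/-- Smooth maps of Frölicher spaces. -/
def FrlSmooth {X : Type u} {Y : Type v} [FrolicherSpace X] [FrolicherSpace Y] (φ : X → Y) : Prop :=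
  ∀ f ∈ functions (X := Y), f ∘ φ ∈ functions (X := X)

namespace FrlSmooth

variable {X : Type u} {Y : Type v} {Z : Type w}
variable [FrolicherSpace X] [FrolicherSpace Y] [FrolicherSpace Z]

theorem iff_curves {φ : X → Y} :
    FrlSmooth φ ↔ ∀ c ∈ curves (X := X), φ ∘ c ∈ curves (X := Y) := by
  constructor
  · intro h c hc
    rw [mem_curves_iff]
    intro f hf
    exact (mem_functions_iff _).1 (h f hf) c hc
  · intro h f hf
    rw [mem_functions_iff]
    intro c hc
    exact (mem_functions_iff f).1 hf _ (h c hc)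

theorem id : FrlSmooth (fun x : X => x) := fun _ hf => hf

theorem comp {ψ : Y → Z} {φ : X → Y} (hψ : FrlSmooth ψ) (hφ : FrlSmooth φ) :
    FrlSmooth (fun x => ψ (φ x)) := fun f hf => hφ _ (hψ f hf)

theorem const (y : Y) : FrlSmooth (fun _ : X => y) := by
  intro f _
  rw [mem_functions_iff]
  intro c _
  exact contDiff_const

theorem mem_curves_prod {c : ℝ → X × Y} :
    c ∈ curves (X := X × Y) ↔
      (fun s => (c s).1) ∈ curves (X := X) ∧ (fun s => (c s).2) ∈ curves (X := Y) := by
  constructor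
  · intro h
    exact ⟨(mem_curves_iff _).2 fun f hf => h _ (Or.inl ⟨f, hf, rfl⟩),
      (mem_curves_iff _).2 fun f hf => h _ (Or.inr ⟨f, hf, rfl⟩)⟩
  · rintro ⟨h₁, h₂⟩ f (⟨g, hg, rfl⟩ | ⟨g, hg, rfl⟩)
    · exact (mem_curves_iff _).1 h₁ g hg
    · exact (mem_curves_iff _).1 h₂ g hg

theorem fst : FrlSmooth (fun p : X × Y => p.1) :=
  iff_curves.2 fun _ hc => (mem_curves_prod.1 hc).1

theorem snd : FrlSmooth (fun p : X × Y => p.2) :=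
  iff_curves.2 fun _ hc => (mem_curves_prod.1 hc).2

theorem prodMk {φ : Z → X} {ψ : Z → Y} (hφ : FrlSmooth φ) (hψ : FrlSmooth ψ) :
    FrlSmooth (fun z => (φ z, ψ z)) :=
  iff_curves.2 fun c hc => mem_curves_prod.2 ⟨iff_curves.1 hφ c hc, iff_curves.1 hψ c hc⟩

theorem inl : FrlSmooth (Sum.inl : X → X ⊕ Y) := fun _ hf =>
  (mem_functions_iff _).2 fun c hc => hf _ (Or.inl ⟨c, hc, rfl⟩)

theorem inr : FrlSmooth (Sum.inr : Y → X ⊕ Y) := fun _ hf =>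
  (mem_functions_iff _).2 fun c hc => hf _ (Or.inr ⟨c, hc, rfl⟩)

theorem sumElim {φ : X → Z} {ψ : Y → Z} (hφ : FrlSmooth φ) (hψ : FrlSmooth ψ) :
    FrlSmooth (Sum.elim φ ψ) := by
  rintro f hf d (⟨c, hc, rfl⟩ | ⟨c, hc, rfl⟩)
  · exact (mem_functions_iff _).1 (hφ f hf) c hc
  · exact (mem_functions_iff _).1 (hψ f hf) c hc

theorem quotMk (r : X → X → Prop) : FrlSmooth (Quot.mk r) := fun _ hf =>
  (mem_functions_iff _).2 fun c hc => hf _ ⟨c, hc, rfl⟩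

theorem quotLift {r : X → X → Prop} {φ : X → Y} (hφ : FrlSmooth φ)
    (h : ∀ a b, r a b → φ a = φ b) : FrlSmooth (Quot.lift φ h) := by
  rintro f hf d ⟨c, hc, rfl⟩
  exact (mem_functions_iff _).1 (hφ f hf) c hc

theorem mem_curves_unitInterval {c : ℝ → unitInterval} :
    c ∈ curves (X := unitInterval) ↔ ContDiff ℝ ∞ (fun s => (c s : ℝ)) := by
  constructor
  · intro h
    exact h Subtype.val ⟨_root_.id, contDiff_id (𝕜 := ℝ) (E := ℝ) (n := ∞), rfl⟩
  · rintro h f ⟨g, hg, rfl⟩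
    exact ContDiff.comp (g := g) hg h

/-- A smooth real function with values in `[0, 1]` is smooth on the unit interval. -/
theorem unitInterval_of_contDiff {φ : ℝ → ℝ} (hφ : ContDiff ℝ ∞ φ) (h : ∀ t, φ t ∈ unitInterval) :
    FrlSmooth (fun t : unitInterval => (⟨φ t, h t⟩ : unitInterval)) := by
  rw [iff_curves]
  intro c hc
  rw [mem_curves_unitInterval] at hc ⊢
  exact hφ.comp hc

theorem symm : FrlSmooth unitInterval.symm := by
  rw [iff_curves]
  intro c hc
  rw [mem_curves_unitInterval] at hc ⊢
  simpa using contDiff_const.sub hc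

end FrlSmooth

/-- The underlying set of the flattened unit interval. -/
def FlatInterval : Type := unitInterval

/-- The flattened structure on `[0, 1]`: it is generated by the smooth functions on the usual unit
interval that are constant near `0` and constant near `1`. -/
instance FlatInterval.instFrolicherSpace : FrolicherSpace FlatInterval :=
  ofFunctions (X := unitInterval) {f | f ∈ functions (X := unitInterval) ∧
    ∃ ε : ℝ, 0 < ε ∧ ε < 1 / 4 ∧
      (∀ t : unitInterval, (t : ℝ) < ε → f t = f 0) ∧
      (∀ t : unitInterval, 1 - ε < (t : ℝ) → f t = f 1)}

/-- The left endpoint of the flattened unit interval. -/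
def FlatInterval.zero : FlatInterval := (0 : unitInterval)

/-- The right endpoint of the flattened unit interval. -/
def FlatInterval.one : FlatInterval := (1 : unitInterval)

/-- The space `X / S` obtained by identifying the points of `S`, with the final structure. -/
abbrev Collapse {X : Type u} (S : Set X) : Type u :=
  Quot fun x y : X => x ∈ S ∧ y ∈ S

/-- A pointed Frölicher space. -/
structure PointedFrl : Type (u + 1) where
  carrier : Type u
  [str : FrolicherSpace carrier]
  pt : carrier

namespace PointedFrl

instance : CoeSort PointedFrl.{u} (Type u) := ⟨carrier⟩

instance (X : PointedFrl.{u}) : FrolicherSpace X := X.str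

/-- Smooth maps that preserve the basepoint. -/
@[ext]
structure Hom (X : PointedFrl.{u}) (Y : PointedFrl.{v}) where
  toFun : X → Y
  smooth : FrlSmooth toFun
  map_pt : toFun X.pt = Y.pt

instance (X : PointedFrl.{u}) (Y : PointedFrl.{v}) : CoeFun (Hom X Y) fun _ => X → Y := ⟨Hom.toFun⟩

/-- Composition, `g` after `f`. -/
def Hom.comp {X : PointedFrl.{u}} {Y : PointedFrl.{v}} {Z : PointedFrl.{w}}
    (g : Hom Y Z) (f : Hom X Y) : Hom X Z :=
  ⟨fun x => g (f x), g.smooth.comp f.smooth, by rw [f.map_pt, g.map_pt]⟩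

/-- The constant map at the basepoint. -/
def Hom.trivial (X : PointedFrl.{u}) (Y : PointedFrl.{v}) : Hom X Y :=
  ⟨fun _ => Y.pt, FrlSmooth.const _, rfl⟩

/-- Two pointed maps are homotopic if they are joined by a smooth basepoint preserving homotopy
parametrized by the usual unit interval. -/
def Homotopic {X : PointedFrl.{u}} {Y : PointedFrl.{v}} (f g : Hom X Y) : Prop :=
  ∃ H : unitInterval × X → Y, FrlSmooth H ∧ (∀ t, H (t, X.pt) = Y.pt) ∧
    (∀ x, H (0, x) = f x) ∧ (∀ x, H (1, x) = g x)

theorem Homotopic.refl {X : PointedFrl.{u}} {Y : PointedFrl.{v}} (f : Hom X Y) : Homotopic f f :=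
  ⟨fun p => f p.2, f.smooth.comp FrlSmooth.snd, fun _ => f.map_pt, fun _ => rfl, fun _ => rfl⟩

theorem Homotopic.symm {X : PointedFrl.{u}} {Y : PointedFrl.{v}} {f g : Hom X Y}
    (h : Homotopic f g) : Homotopic g f := by
  obtain ⟨H, hH, hp, h0, h1⟩ := h
  refine ⟨fun p => H (unitInterval.symm p.1, p.2), ?_, fun t => hp _, ?_, ?_⟩
  · exact hH.comp ((FrlSmooth.symm.comp FrlSmooth.fst).prodMk FrlSmooth.snd)
  · intro x; simpa using h1 x
  · intro x; simpa using h0 x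

theorem Homotopic.trans {X : PointedFrl.{u}} {Y : PointedFrl.{v}} {f g k : Hom X Y}
    (h : Homotopic f g) (h' : Homotopic g k) : Homotopic f k := by
  obtain ⟨H, hH, hp, h0, h1⟩ := h
  obtain ⟨H', hH', hp', h0', h1'⟩ := h'
  have mem : ∀ t, Real.smoothTransition t ∈ unitInterval := fun t =>
    ⟨Real.smoothTransition.nonneg t, Real.smoothTransition.le_one t⟩
  let σ : unitInterval → unitInterval := fun t => ⟨Real.smoothTransition (2 * t), mem _⟩
  let τ : unitInterval → unitInterval := fun t =>
    ⟨Real.smoothTransition (5 / 2 * t - 3 / 2), mem _⟩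
  have hσ : FrlSmooth σ := FrlSmooth.unitInterval_of_contDiff
    (φ := fun t => Real.smoothTransition (2 * t))
    (Real.smoothTransition.contDiff.comp (by fun_prop)) fun _ => mem _
  have hτ : FrlSmooth τ := FrlSmooth.unitInterval_of_contDiff
    (φ := fun t => Real.smoothTransition (5 / 2 * t - 3 / 2))
    (Real.smoothTransition.contDiff.comp (by fun_prop)) fun _ => mem _
  have σ1 : ∀ t : unitInterval, 1 / 2 ≤ (t : ℝ) → σ t = 1 := fun t ht =>
    Subtype.ext (Real.smoothTransition.one_of_one_le (by linarith))
  have τ0 : ∀ t : unitInterval, (t : ℝ) ≤ 3 / 5 → τ t = 0 := fun t ht =>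
    Subtype.ext (Real.smoothTransition.zero_of_nonpos (by linarith))
  have σ0 : σ 0 = 0 := Subtype.ext (Real.smoothTransition.zero_of_nonpos (by simp))
  have τ1 : τ 1 = 1 := Subtype.ext (Real.smoothTransition.one_of_one_le (by norm_num))
  have hHσ : FrlSmooth fun p : unitInterval × X => H (σ p.1, p.2) :=
    hH.comp ((hσ.comp FrlSmooth.fst).prodMk FrlSmooth.snd)
  have hHτ : FrlSmooth fun p : unitInterval × X => H' (τ p.1, p.2) :=
    hH'.comp ((hτ.comp FrlSmooth.fst).prodMk FrlSmooth.snd)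
  let K : unitInterval × X → Y := fun p =>
    if (p.1 : ℝ) ≤ 1 / 2 then H (σ p.1, p.2) else H' (τ p.1, p.2)
  have Kσ : ∀ p : unitInterval × X, (p.1 : ℝ) < 3 / 5 → K p = H (σ p.1, p.2) := by
    intro p hlt
    by_cases hle : (p.1 : ℝ) ≤ 1 / 2
    · simp only [K, if_pos hle]
    · simp only [K, if_neg hle]
      rw [τ0 _ hlt.le, σ1 _ (not_le.1 hle).le, h0', h1]
  have Kτ : ∀ p : unitInterval × X, 1 / 2 < (p.1 : ℝ) → K p = H' (τ p.1, p.2) := by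
    intro p hlt
    simp only [K, if_neg (not_le.2 hlt)]
  refine ⟨K, ?_, ?_, ?_, ?_⟩
  · intro e he
    rw [mem_functions_iff]
    intro c hc
    have ht : ContDiff ℝ ∞ fun s => ((c s).1 : ℝ) :=
      FrlSmooth.mem_curves_unitInterval.1 (FrlSmooth.mem_curves_prod.1 hc).1
    have c1 := (mem_functions_iff _).1 (hHσ e he) c hc
    have c2 := (mem_functions_iff _).1 (hHτ e he) c hc
    rw [contDiff_iff_contDiffAt]
    intro s
    by_cases hs : ((c s).1 : ℝ) < 3 / 5
    · refine c1.contDiffAt.congr_of_eventuallyEq ?_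
      filter_upwards [ht.continuous.continuousAt.eventually_lt continuousAt_const hs] with r hr
      simp only [Function.comp_apply]
      rw [Kσ _ hr]
    · refine c2.contDiffAt.congr_of_eventuallyEq ?_
      have hs' : 1 / 2 < ((c s).1 : ℝ) := by linarith [not_lt.1 hs]
      filter_upwards [continuousAt_const.eventually_lt ht.continuous.continuousAt hs'] with r hr
      simp only [Function.comp_apply]
      rw [Kτ _ hr]
  · intro t
    by_cases hle : (t : ℝ) ≤ 1 / 2
    · simp only [K, if_pos hle, hp]
    · simp only [K, if_neg hle, hp']
  · intro x
    rw [Kσ _ (by norm_num), σ0, h0]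
  · intro x
    rw [Kτ _ (by norm_num), τ1, h1']

/-- Pointed smooth homotopy as an equivalence relation. -/
def homotopySetoid (X : PointedFrl.{u}) (Y : PointedFrl.{v}) : Setoid (Hom X Y) where
  r := Homotopic
  iseqv := ⟨Homotopic.refl, Homotopic.symm, Homotopic.trans⟩

/-- The pointed set `[X, W]` of homotopy classes of pointed smooth maps; its basepoint is the class
of the constant map. -/
def HomotopyClasses (X : PointedFrl.{u}) (W : PointedFrl.{v}) : Pointed.{max u v} where
  X := Quotient (homotopySetoid X W)
  point := Quotient.mk (homotopySetoid X W) (Hom.trivial X W)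

/-- The map `f^* : [Y, W] → [X, W]`, `[g] ↦ [g ∘ f]`. -/
def Hom.pullback {X Y : PointedFrl.{u}} (f : Hom X Y) (W : PointedFrl.{v}) :
    Pointed.Hom (HomotopyClasses Y W) (HomotopyClasses X W) where
  toFun := Quotient.map (fun g : Hom Y W => g.comp f) (by
    rintro g g' ⟨H, hH, hp, h0, h1⟩
    refine ⟨fun p => H (p.1, f p.2), ?_, ?_, fun x => h0 _, fun x => h1 _⟩
    · exact hH.comp (FrlSmooth.fst.prodMk (f.smooth.comp FrlSmooth.snd))
    · intro t
      change H (t, f X.pt) = _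
      rw [f.map_pt, hp])
  map_point := rfl

/-- The smash product (reduced join) `X ∧ Y`. -/
def smash (X : PointedFrl.{u}) (Y : PointedFrl.{v}) : PointedFrl.{max u v} where
  carrier := Collapse {p : X × Y | p.1 = X.pt ∨ p.2 = Y.pt}
  pt := Quot.mk _ (X.pt, Y.pt)

/-- The space `𝐈 / {0, 1}`, pointed by the class of the endpoints. -/
def flatCircle : PointedFrl.{0} where
  carrier := Collapse {t : FlatInterval | t = FlatInterval.zero ∨ t = FlatInterval.one}
  pt := Quot.mk _ FlatInterval.zero

/-- The reduced flattened suspension. -/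
def susp (X : PointedFrl.{u}) : PointedFrl.{u} := smash flatCircle X

/-- The point `t ∧ x` of the suspension. -/
def suspMk {X : PointedFrl.{u}} (t : FlatInterval) (x : X) : susp X :=
  Quot.mk _ ((Quot.mk _ t : flatCircle), x)

theorem suspMk_eq_pt {X : PointedFrl.{u}} {t : FlatInterval} {x : X}
    (h : t = FlatInterval.zero ∨ t = FlatInterval.one ∨ x = X.pt) :
    suspMk t x = (susp X).pt := by
  refine Quot.sound ⟨?_, Or.inl rfl⟩
  rcases h with rfl | rfl | rfl
  · exact Or.inl rfl
  · exact Or.inl (Quot.sound ⟨Or.inr rfl, Or.inl rfl⟩)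
  · exact Or.inr rfl

theorem suspMk_smooth {X : PointedFrl.{u}} :
    FrlSmooth fun p : FlatInterval × X => suspMk p.1 p.2 :=
  (FrlSmooth.quotMk _).comp (((FrlSmooth.quotMk _).comp FrlSmooth.fst).prodMk FrlSmooth.snd)

/-- The suspension of a pointed map, `[s, x] ↦ [s, f x]`. -/
def Hom.susp {X Y : PointedFrl.{u}} (f : Hom X Y) :
    Hom (PointedFrl.susp X) (PointedFrl.susp Y) where
  toFun := Quot.lift
    (fun p : flatCircle × X => (Quot.mk _ (p.1, f p.2) : PointedFrl.susp Y)) (by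
      rintro a b ⟨ha, hb⟩
      refine Quot.sound ⟨ha.imp id fun h => ?_, hb.imp id fun h => ?_⟩
      · simp only [h, f.map_pt]
      · simp only [h, f.map_pt])
  smooth := FrlSmooth.quotLift
    ((FrlSmooth.quotMk _).comp (FrlSmooth.fst.prodMk (f.smooth.comp FrlSmooth.snd))) _
  map_pt := congrArg (fun y => (Quot.mk _ (flatCircle.pt, y) : PointedFrl.susp Y)) f.map_pt

/-- The iterated suspension, with `Σⁿ⁺¹ X = Σⁿ (Σ X)`. -/
def iterSusp : ℕ → PointedFrl.{u} → PointedFrl.{u}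
  | 0, X => X
  | n + 1, X => iterSusp n (susp X)

/-- The iterated suspension of a pointed map. -/
def Hom.iterSusp : ∀ (n : ℕ) {X Y : PointedFrl.{u}}, Hom X Y →
    Hom (PointedFrl.iterSusp n X) (PointedFrl.iterSusp n Y)
  | 0, _, _, f => f
  | n + 1, _, _, f => Hom.iterSusp n f.susp

/-- The flattened mapping cylinder `𝐈_f`: the pushout of `f : A → X` along `a ↦ (1, a)`. -/
abbrev FlatCylinder {A X : PointedFrl.{u}} (f : Hom A X) : Type u :=
  Quot fun p q : (FlatInterval × A) ⊕ X =>
    ∃ a : A, p = Sum.inl (FlatInterval.one, a) ∧ q = Sum.inr (f a)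

/-- The subset `{0} × A ∪ 𝐈 × {a₀}` of the flattened mapping cylinder. -/
def flatConeBase {A X : PointedFrl.{u}} (f : Hom A X) : Set (FlatCylinder f) :=
  {z | ∃ (t : FlatInterval) (a : A), (t = FlatInterval.zero ∨ a = A.pt) ∧
    z = Quot.mk _ (Sum.inl (t, a))}

/-- The flattened mapping cone `𝐓_f` in the pointed category: in the flattened mapping cylinder
the bottom `{0} × A` and the interval `𝐈 × {a₀}` over the basepoint are identified to one point,
the basepoint, which is also the class of the basepoint of `X`. -/
def flatCone {A X : PointedFrl.{u}} (f : Hom A X) : PointedFrl.{u} where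
  carrier := Collapse (flatConeBase f)
  pt := Quot.mk _ (Quot.mk _ (Sum.inl (FlatInterval.zero, A.pt)))

/-- The inclusion `j : X → 𝐓_f`, `x ↦ [x]`. -/
def coneIncl {A X : PointedFrl.{u}} (f : Hom A X) : Hom X (flatCone f) where
  toFun x := Quot.mk _ (Quot.mk _ (Sum.inr x))
  smooth := (FrlSmooth.quotMk _).comp ((FrlSmooth.quotMk _).comp FrlSmooth.inr)
  map_pt := by
    refine Quot.sound ⟨⟨FlatInterval.one, A.pt, Or.inr rfl, ?_⟩,
      ⟨FlatInterval.zero, A.pt, Or.inr rfl, rfl⟩⟩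
    exact (Quot.sound ⟨A.pt, rfl, by rw [f.map_pt]⟩).symm

/-- The map `𝐈_f → Σ A`, `[t, a] ↦ t ∧ a`, `[x] ↦ *`. -/
def cylinderQuot {A X : PointedFrl.{u}} (f : Hom A X) : FlatCylinder f → susp A :=
  Quot.lift (Sum.elim (fun p : FlatInterval × A => suspMk p.1 p.2) fun _ => (susp A).pt) (by
    rintro _ _ ⟨a, rfl, rfl⟩
    exact suspMk_eq_pt (Or.inr (Or.inl rfl)))

theorem cylinderQuot_eq_pt {A X : PointedFrl.{u}} (f : Hom A X) {z : FlatCylinder f}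
    (hz : z ∈ flatConeBase f) : cylinderQuot f z = (susp A).pt := by
  obtain ⟨t, a, h, rfl⟩ := hz
  exact suspMk_eq_pt (h.imp id Or.inr)

/-- The quotient map `k : 𝐓_f → Σ A` that collapses `X` to the basepoint: `[t, a] ↦ t ∧ a` and
`[x] ↦ *`. -/
def coneQuot {A X : PointedFrl.{u}} (f : Hom A X) : Hom (flatCone f) (susp A) where
  toFun := Quot.lift (cylinderQuot f) fun _ _ h =>
    (cylinderQuot_eq_pt f h.1).trans (cylinderQuot_eq_pt f h.2).symm
  smooth := FrlSmooth.quotLift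
    (FrlSmooth.quotLift (FrlSmooth.sumElim suspMk_smooth (FrlSmooth.const _)) _) _
  map_pt := rfl

/-- A smooth braking function `α_ε`. -/
structure IsBraking (ε : ℝ) (α : ℝ → ℝ) : Prop where
  smooth : ContDiff ℝ ∞ α
  eq_zero : ∀ t ≤ ε, α t = 0
  mem_Ioo : ∀ t, ε < t → t < 1 - ε → 0 < α t ∧ α t < 1
  strictMono : StrictMonoOn α (Set.Ioo ε (1 - ε))
  eq_one : ∀ t, 1 - ε ≤ t → α t = 1

/-- A smooth cofibration in the pointed category: an injective pointed map `i : A → X` such that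
for every pointed map `f : X → Z` and pointed homotopy `G` starting at `f ∘ i`, the homotopy
`(t, a) ↦ G (α_ε t, a)`, for some braking function with `0 < ε < 1 / 2`, extends to a pointed
homotopy on `X` starting at `f`. The projection `Set.projIcc` does nothing but restrict the codomain
of the braking function to `[0, 1]`. -/
structure IsCofibration {A X : PointedFrl.{u}} (i : Hom A X) : Prop where
  injective : Function.Injective i
  extend : ∀ (Z : PointedFrl.{u}) (f : Hom X Z) (G : unitInterval × A → Z), FrlSmooth G →
    (∀ t, G (t, A.pt) = Z.pt) → (∀ a, G (0, a) = f (i a)) →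
    ∃ (ε : ℝ) (α : ℝ → ℝ), 0 < ε ∧ ε < 1 / 2 ∧ IsBraking ε α ∧
      ∃ F : unitInterval × X → Z, FrlSmooth F ∧ (∀ t, F (t, X.pt) = Z.pt) ∧
        (∀ x, F (0, x) = f x) ∧
        ∀ (t : unitInterval) (a : A), F (t, i a) = G (Set.projIcc 0 1 zero_le_one (α t), a)

end PointedFrl

/-- Exactness of `P → Q → R` at `Q`, for maps of pointed sets: the image of the first map is the
preimage of the basepoint under the second. -/
def Pointed.ExactAt {P Q R : Pointed.{u}} (f : Pointed.Hom P Q) (g : Pointed.Hom Q R) : Prop :=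
  Set.range f.toFun = g.toFun ⁻¹' {R.point}

/-!
A pointed map `h : X → W` extends over `𝐓_i` as soon as `h ∘ i` is null homotopic: the null homotopy
is the map on the cone.
For exactness at `𝐓_i`, a null homotopy of the restriction of `h : 𝐓_i → W` to `X` is attached to
the upper half of the cone, so that `h` becomes homotopic to a map which is trivial on `X` and hence
factors through `Σ A`. For exactness at `Σ A`, a null homotopy of `g ∘ k` on `𝐓_i` restricts to a
family of loops parametrised by `X`, and deforming a path along the boundary of the square
identifies this family on `A` with `g`. Since `Σ` is left adjoint to the smooth loop space, the case
of a general `n` is the case `n = 0` for the iterated loop space of `W`.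

Two facts make these constructions smooth. Products with a fixed space preserve quotients: this is
cartesian closedness, which rests on Boman's theorem in the plane and, for generated structures,
on the uniform boundedness principle. And the identity of the flattened interval is homotopic, rel
endpoints, to a map which is locally constant at the endpoints, so smooth maps may be glued along
flattened intervals.
-/

universe x

section Analysis

open Filter Topology Set MeasureTheory
open scoped FourierTransform RealInnerProductSpace

section FourierRegularity

variable {E : Type*} [NormedAddCommGroup E] [NormedSpace ℂ E]

theorem contDiff_of_fourier_decay [CompleteSpace E] {V : Type*} [NormedAddCommGroup V]
    [InnerProductSpace ℝ V] [FiniteDimensional ℝ V] [MeasurableSpace V] [BorelSpace V]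
    {f : V → E} (hf : Continuous f) (hint : Integrable f)
    (hdecay : ∀ k : ℕ, ∃ C, ∀ w, ‖w‖ ^ k * ‖𝓕 f w‖ ≤ C) : ContDiff ℝ ∞ f := by
  have hcont : Continuous (𝓕 f) := VectorFourier.fourierIntegral_continuous
    Real.continuous_fourierChar continuous_inner hint
  choose C hC using hdecay
  have hmoment (k : ℕ) : Integrable fun w => ‖w‖ ^ k * ‖𝓕 f w‖ :=
    integrable_of_le_of_pow_mul_le (fun w => by simpa using hC 0 w) (hC _)
      hcont.aestronglyMeasurable
  have hFint : Integrable (𝓕 f) := by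
    rw [← integrable_norm_iff hcont.aestronglyMeasurable]
    simpa using hmoment 0
  have hsmooth : ContDiff ℝ ∞ (𝓕 (𝓕 f)) := Real.contDiff_fourier fun k _ => hmoment k
  rw [← hf.fourierInv_fourier_eq hint hFint]
  convert hsmooth.comp contDiff_neg using 1
  exact funext fun w => Real.fourierInv_eq_fourier_neg _ w

theorem pow_mul_norm_fourier_le {g : ℝ → E} {R C : ℝ} {p : ℕ} (hg : ContDiff ℝ ∞ g)
    (hsupp : ∀ s ∉ Icc (-R) R, g s = 0)
    (hC : ∀ s ∈ Icc (-R) R, ‖iteratedDeriv p g s‖ ≤ C) (ξ : ℝ) :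
    |ξ| ^ p * ‖𝓕 g ξ‖ ≤ C * volume.real (Icc (-R) R) := by
  have hsub : tsupport g ⊆ Icc (-R) R :=
    closure_minimal (fun s hs => by_contra fun h => hs (hsupp s h)) isClosed_Icc
  have hzero (n : ℕ) : ∀ s ∉ Icc (-R) R, iteratedDeriv n g s = 0 := fun s hs => by
    rw [iteratedDeriv, image_eq_zero_of_notMem_tsupport fun h =>
      hs (hsub (tsupport_iteratedFDeriv_subset n h))]
    rfl
  have hF := congr_fun (Real.fourier_iteratedDeriv (N := ⊤) (n := p) hg
    (fun n _ => (hg.continuous_iteratedDeriv n (mod_cast le_top)).integrable_of_hasCompactSupport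
      (.intro isCompact_Icc (hzero n))) le_top) ξ
  calc |ξ| ^ p * ‖𝓕 g ξ‖ ≤ ‖(2 * Real.pi * Complex.I * ξ) ^ p • 𝓕 g ξ‖ := by
        rw [norm_smul, norm_pow]
        gcongr
        simp only [Complex.norm_mul, Complex.norm_ofNat, Complex.norm_real, Complex.norm_I,
          Real.norm_eq_abs, abs_of_pos Real.pi_pos, mul_one]
        nlinarith [abs_nonneg ξ, Real.pi_gt_three]
    _ = ‖∫ s, 𝐞 (-(s * ξ)) • iteratedDeriv p g s‖ := by rw [← hF, Real.fourier_real_eq]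
    _ = ‖∫ s in Icc (-R) R, 𝐞 (-(s * ξ)) • iteratedDeriv p g s‖ := by
        rw [setIntegral_eq_integral_of_forall_compl_eq_zero fun s hs => by
          rw [hzero p s hs, smul_zero]]
    _ ≤ C * volume.real (Icc (-R) R) :=
        norm_setIntegral_le_of_norm_le_const measure_Icc_lt_top fun s hs => by
          simpa using hC s hs

theorem fourier_withLp_prod {f : ℝ → ℝ → E} (hint : Integrable (Function.uncurry f))
    (w : WithLp 2 (ℝ × ℝ)) :
    𝓕 (fun v : WithLp 2 (ℝ × ℝ) => f v.fst v.snd) w =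
      ∫ t, 𝐞 (-(t * w.snd)) • 𝓕 (fun s => f s t) w.fst := by
  rw [Real.fourier_eq, ← (WithLp.volume_preserving_toLp ℝ ℝ).integral_comp
    (WithLp.homeomorphProd 2 ℝ ℝ).symm.measurableEmbedding, Measure.volume_eq_prod,
    integral_prod_symm]
  · refine integral_congr_ae (.of_forall fun t => ?_)
    simp only [Real.fourier_real_eq, Circle.smul_def, ← integral_smul, smul_smul,
      WithLp.prod_inner_apply, ← Circle.coe_mul, ← AddChar.map_add_eq_mul]
    refine integral_congr_ae (.of_forall fun s => ?_)
    simp [mul_comm]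
  · refine hint.mono (.smul ?_ hint.1) (.of_forall fun x => ?_)
    · have hphase : Continuous fun x : ℝ × ℝ => -⟪WithLp.toLp 2 x, w⟫ := by fun_prop
      exact (continuous_subtype_val.comp
        (Real.continuous_fourierChar.comp hphase)).aestronglyMeasurable
    · simp [Function.uncurry]

end FourierRegularity

section Partials

variable {F : Type*} [NormedAddCommGroup F] [NormedSpace ℝ F]

/-- The function `f` is smooth in its first variable, and each of its derivatives in that variable
is bounded on bounded subsets of the plane. -/
structure HasLocallyBoundedPartials (f : ℝ → ℝ → F) : Prop where
  contDiff (t : ℝ) : ContDiff ℝ ∞ fun s => f s t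
  exists_bound (p : ℕ) (R : ℝ) :
    ∃ C, ∀ s ∈ Icc (-R) R, ∀ t ∈ Icc (-R) R, ‖iteratedDeriv p (fun s => f s t) s‖ ≤ C

namespace HasLocallyBoundedPartials

variable {f : ℝ → ℝ → F}

theorem smul (hf : HasLocallyBoundedPartials f) {φ ψ : ℝ → ℝ} (hφ : ContDiff ℝ ∞ φ)
    (hψ : Continuous ψ) : HasLocallyBoundedPartials fun s t => (ψ t * φ s) • f s t where
  contDiff t := (contDiff_const.mul hφ).smul (hf.contDiff t)
  exists_bound p R := by
    choose C hC using fun n => hf.exists_bound n R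
    choose D hD using fun n => isCompact_Icc.exists_bound_of_continuousOn (s := Icc (-R) R)
      (hφ.continuous_iteratedDeriv n (mod_cast le_top)).continuousOn
    obtain ⟨B, hB⟩ := isCompact_Icc.exists_bound_of_continuousOn (s := Icc (-R) R) hψ.continuousOn
    refine ⟨B * ∑ n ∈ Finset.range (p + 1), p.choose n * D n * C (p - n), fun s hs t ht => ?_⟩
    have hD0 (n) : 0 ≤ D n := (norm_nonneg _).trans (hD n s hs)
    have hB0 : 0 ≤ B := (norm_nonneg _).trans (hB t ht)
    have hscale : iteratedDeriv p (fun s => (ψ t * φ s) • f s t) s =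
        ψ t • iteratedDeriv p (fun s => φ s • f s t) s := by
      simp only [mul_smul]
      exact iteratedDeriv_const_smul_field ..
    rw [hscale, norm_smul, ← norm_iteratedFDeriv_eq_norm_iteratedDeriv]
    gcongr
    · exact hB t ht
    refine (norm_iteratedFDeriv_smul_le hφ (hf.contDiff t) s (mod_cast le_top)).trans
      (Finset.sum_le_sum fun n _ => ?_)
    simp only [norm_iteratedFDeriv_eq_norm_iteratedDeriv]
    gcongr
    exacts [mul_nonneg (Nat.cast_nonneg _) (hD0 n), hD n s hs, hC _ s hs t ht]

theorem comp_linearIsometry {G : Type*} [NormedAddCommGroup G] [NormedSpace ℝ G] (L : F →ₗᵢ[ℝ] G)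
    (hf : HasLocallyBoundedPartials f) : HasLocallyBoundedPartials fun s t => L (f s t) where
  contDiff t := L.contDiff.comp (hf.contDiff t)
  exists_bound p R := by
    obtain ⟨C, hC⟩ := hf.exists_bound p R
    refine ⟨C, fun s hs t ht => ?_⟩
    have hnorm := L.norm_iteratedFDeriv_comp_left (hf.contDiff t).contDiffAt (i := p) (x := s)
      (mod_cast le_top)
    simp only [norm_iteratedFDeriv_eq_norm_iteratedDeriv] at hnorm
    exact hnorm.trans_le (hC s hs t ht)

theorem exists_norm_sub_le (hf : HasLocallyBoundedPartials f) (R : ℝ) :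
    ∃ C, ∀ s ∈ Icc (-R) R, ∀ s' ∈ Icc (-R) R, ∀ t ∈ Icc (-R) R,
      ‖f s' t - f s t‖ ≤ C * |s' - s| := by
  obtain ⟨C, hC⟩ := hf.exists_bound 1 R
  refine ⟨C, fun s hs s' hs' t ht => ?_⟩
  exact (convex_Icc (-R) R).norm_image_sub_le_of_norm_deriv_le (f := fun s => f s t)
    (fun x _ => (hf.contDiff t).differentiable (by simp) x)
    (fun x hx => by simpa using hC x hx t ht) hs hs'

theorem continuous_uncurry (hf : HasLocallyBoundedPartials f)
    (hf' : HasLocallyBoundedPartials fun s t => f t s) : Continuous (Function.uncurry f) := by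
  rw [continuous_iff_continuousAt]
  rintro ⟨s₀, t₀⟩
  set R := max |s₀| |t₀| + 1
  obtain ⟨C, hC⟩ := hf.exists_norm_sub_le R
  obtain ⟨D, hD⟩ := hf'.exists_norm_sub_le R
  have hs₀ : |s₀| < R := (le_max_left _ _).trans_lt (lt_add_one _)
  have ht₀ : |t₀| < R := (le_max_right _ _).trans_lt (lt_add_one _)
  have hlim : Tendsto (fun x : ℝ × ℝ => C * |x.1 - s₀| + D * |x.2 - t₀|) (𝓝 (s₀, t₀)) (𝓝 0) := by
    have : Continuous fun x : ℝ × ℝ => C * |x.1 - s₀| + D * |x.2 - t₀| := by fun_prop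
    simpa using this.tendsto (s₀, t₀)
  rw [ContinuousAt, tendsto_iff_norm_sub_tendsto_zero]
  refine squeeze_zero' (.of_forall fun _ => norm_nonneg _) ?_ hlim
  filter_upwards [(continuous_fst.abs.tendsto (s₀, t₀)).eventually_lt_const hs₀,
    (continuous_snd.abs.tendsto (s₀, t₀)).eventually_lt_const ht₀] with x hx₁ hx₂
  calc ‖f x.1 x.2 - f s₀ t₀‖ ≤ ‖f x.1 x.2 - f s₀ x.2‖ + ‖f s₀ x.2 - f s₀ t₀‖ :=
        norm_sub_le_norm_sub_add_norm_sub ..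
    _ ≤ C * |x.1 - s₀| + D * |x.2 - t₀| :=
        add_le_add (hC _ (abs_le.1 hs₀.le) _ (abs_le.1 hx₁.le) _ (abs_le.1 hx₂.le))
          (hD _ (abs_le.1 ht₀.le) _ (abs_le.1 hx₂.le) _ (abs_le.1 hs₀.le))

end HasLocallyBoundedPartials

end Partials

section PlaneRegularity

variable {E : Type*} [NormedAddCommGroup E] [NormedSpace ℂ E] {f : ℝ → ℝ → E}

theorem HasLocallyBoundedPartials.exists_pow_mul_norm_fourier_le
    (hf : HasLocallyBoundedPartials f) {R : ℝ}
    (hsupp : ∀ s t, s ∉ Icc (-R) R ∨ t ∉ Icc (-R) R → f s t = 0)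
    (hint : Integrable (Function.uncurry f)) (p : ℕ) :
    ∃ C, ∀ w : WithLp 2 (ℝ × ℝ),
      |w.fst| ^ p * ‖𝓕 (fun v : WithLp 2 (ℝ × ℝ) => f v.fst v.snd) w‖ ≤ C := by
  obtain ⟨C, hC⟩ := hf.exists_bound p R
  refine ⟨C * volume.real (Icc (-R) R) * volume.real (Icc (-R) R), fun w => ?_⟩
  have hslice (t) (ht : t ∈ Icc (-R) R) :
      |w.fst| ^ p * ‖𝓕 (fun s => f s t) w.fst‖ ≤ C * volume.real (Icc (-R) R) :=
    pow_mul_norm_fourier_le (hf.contDiff t) (fun s hs => hsupp s t (.inl hs))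
      (fun s hs => hC s hs t ht) w.fst
  have hzero (t) (ht : t ∉ Icc (-R) R) : 𝓕 (fun s => f s t) w.fst = 0 := by
    simp [Real.fourier_real_eq, hsupp _ t (.inr ht)]
  calc |w.fst| ^ p * ‖𝓕 (fun v : WithLp 2 (ℝ × ℝ) => f v.fst v.snd) w‖
      = ‖∫ t in Icc (-R) R, |w.fst| ^ p • 𝐞 (-(t * w.snd)) • 𝓕 (fun s => f s t) w.fst‖ := by
        rw [fourier_withLp_prod hint, integral_smul, norm_smul, norm_pow, Real.norm_eq_abs,
          abs_abs, setIntegral_eq_integral_of_forall_compl_eq_zero fun t ht => by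
            rw [hzero t ht, smul_zero]]
    _ ≤ _ := norm_setIntegral_le_of_norm_le_const measure_Icc_lt_top fun t ht => by
        simpa [norm_smul] using hslice t ht

variable [CompleteSpace E]

theorem contDiff_uncurry_of_support (hf : HasLocallyBoundedPartials f)
    (hf' : HasLocallyBoundedPartials fun s t => f t s) {R : ℝ}
    (hsupp : ∀ s t, s ∉ Icc (-R) R ∨ t ∉ Icc (-R) R → f s t = 0) :
    ContDiff ℝ ∞ (Function.uncurry f) := by
  have hint : Integrable (Function.uncurry f) :=
    (hf.continuous_uncurry hf').integrable_of_hasCompactSupport <|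
      .intro (isCompact_Icc.prod isCompact_Icc) fun x hx => hsupp x.1 x.2 (not_and_or.1 hx)
  let U : WithLp 2 (ℝ × ℝ) → E := fun v => f v.fst v.snd
  have hU : Continuous U := (hf.continuous_uncurry hf').comp (WithLp.prod_continuous_ofLp 2 ℝ ℝ)
  have hUint : Integrable U :=
    (WithLp.volume_preserving_ofLp ℝ ℝ).integrable_comp_of_integrable hint
  have hswap (w) : 𝓕 U w = 𝓕 (fun v : WithLp 2 (ℝ × ℝ) => f v.snd v.fst)
      (.toLp 2 (w.snd, w.fst)) :=
    Real.fourier_comp_linearIsometry (LinearIsometryEquiv.withLpProdComm 2 ℝ ℝ ℝ)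
      (fun v => f v.snd v.fst) w
  have hdecay (k : ℕ) : ∃ C, ∀ w, ‖w‖ ^ k * ‖𝓕 U w‖ ≤ C := by
    obtain ⟨C, hC⟩ := hf.exists_pow_mul_norm_fourier_le hsupp hint k
    obtain ⟨D, hD⟩ := hf'.exists_pow_mul_norm_fourier_le (fun s t h => hsupp t s h.symm)
      hint.swap k
    refine ⟨2 ^ (k - 1) * (C + D), fun w => ?_⟩
    have hnorm : ‖w‖ ^ k ≤ 2 ^ (k - 1) * (|w.fst| ^ k + |w.snd| ^ k) := by
      refine (pow_le_pow_left₀ (norm_nonneg w) ?_ k).trans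
        (add_pow_le (abs_nonneg _) (abs_nonneg _) k)
      rw [WithLp.prod_norm_eq_of_L2]
      refine Real.sqrt_le_iff.2 ⟨by positivity, ?_⟩
      simp only [Real.norm_eq_abs]
      nlinarith [abs_nonneg w.fst, abs_nonneg w.snd,
        mul_nonneg (abs_nonneg w.fst) (abs_nonneg w.snd)]
    calc ‖w‖ ^ k * ‖𝓕 U w‖ ≤ 2 ^ (k - 1) * (|w.fst| ^ k + |w.snd| ^ k) * ‖𝓕 U w‖ := by gcongr
      _ = 2 ^ (k - 1) * (|w.fst| ^ k * ‖𝓕 U w‖ + |w.snd| ^ k * ‖𝓕 U w‖) := by ring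
      _ ≤ 2 ^ (k - 1) * (C + D) := by
        gcongr
        · exact hC w
        · rw [hswap]
          exact hD (.toLp 2 (w.snd, w.fst))
  exact (contDiff_of_fourier_decay hU hUint hdecay).comp
    (WithLp.prodContinuousLinearEquiv 2 ℝ ℝ ℝ).symm.contDiff

theorem HasLocallyBoundedPartials.contDiff_uncurry (hf : HasLocallyBoundedPartials f)
    (hf' : HasLocallyBoundedPartials fun s t => f t s) :
    ContDiff ℝ ∞ (Function.uncurry f) := by
  rw [contDiff_iff_contDiffAt]
  intro x
  let χ : ContDiffBump (0 : ℝ) := ⟨‖x‖ + 1, ‖x‖ + 2, by positivity, by linarith⟩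
  have hχ (s) (hs : s ∉ Icc (-(‖x‖ + 2)) (‖x‖ + 2)) : χ s = 0 := by
    refine χ.zero_of_le_dist ?_
    rw [Real.dist_0_eq_abs]
    exact (not_le.1 (mt abs_le.1 hs)).le
  have hχx : ∀ᶠ y : ℝ × ℝ in 𝓝 x, χ y.1 = 1 ∧ χ y.2 = 1 := by
    filter_upwards [Metric.ball_mem_nhds x one_pos] with y hy
    have hyx : ‖y‖ ≤ ‖x‖ + 1 := by
      linarith [norm_le_norm_add_norm_sub' y x, mem_ball_iff_norm.1 hy]
    exact ⟨χ.one_of_mem_closedBall (mem_closedBall_zero_iff.2 ((norm_fst_le y).trans hyx)),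
      χ.one_of_mem_closedBall (mem_closedBall_zero_iff.2 ((norm_snd_le y).trans hyx))⟩
  have hsmooth : ContDiff ℝ ∞ (Function.uncurry fun s t => (χ t * χ s) • f s t) :=
    contDiff_uncurry_of_support (R := ‖x‖ + 2) (hf.smul χ.contDiff χ.continuous)
      (by simpa only [mul_comm] using hf'.smul χ.contDiff χ.continuous)
      (by rintro s t (h | h) <;> simp [hχ _ h])
  refine hsmooth.contDiffAt.congr_of_eventuallyEq ?_
  filter_upwards [hχx] with y hy
  simp [Function.uncurry, hy.1, hy.2]

theorem HasLocallyBoundedPartials.contDiff_uncurry_real {f : ℝ → ℝ → ℝ}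
    (hf : HasLocallyBoundedPartials f) (hf' : HasLocallyBoundedPartials fun s t => f t s) :
    ContDiff ℝ ∞ (Function.uncurry f) :=
  Complex.reCLM.contDiff.comp <| (hf.comp_linearIsometry Complex.ofRealLI).contDiff_uncurry
    (hf'.comp_linearIsometry Complex.ofRealLI)

end PlaneRegularity

end Analysis

section SpecialCurves

open Filter Topology Set

theorem iteratedDeriv_comp_affine {E : Type*} [NormedAddCommGroup E] [NormedSpace ℝ E]
    {f : ℝ → E} (hf : ContDiff ℝ ∞ f) (a v r : ℝ) (p : ℕ) :
    iteratedDeriv p (fun u => f (a + v * (u - r))) =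
      fun u => v ^ p • iteratedDeriv p f (a + v * (u - r)) := by
  have hshift : ContDiff ℝ p fun y => f (a + y) :=
    (hf.comp (contDiff_const.add contDiff_id)).of_le (mod_cast le_top)
  rw [iteratedDeriv_comp_sub_const p (fun u => f (a + v * u)) r]
  funext u
  rw [iteratedDeriv_comp_const_smul hshift, iteratedDeriv_comp_const_add]

/-- The factor by which a bump function is compressed to fit between the neighbouring times
`specialTime n`. -/
noncomputable def specialScale (n : ℕ) : ℝ := 8 * ((n : ℝ) + 2) ^ 2

theorem one_le_specialScale (n : ℕ) : 1 ≤ specialScale n := by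
  have : (0 : ℝ) ≤ n := n.cast_nonneg
  unfold specialScale
  nlinarith

theorem specialScale_pos (n : ℕ) : 0 < specialScale n :=
  one_pos.trans_le (one_le_specialScale n)

theorem summable_geometric_mul_specialScale_pow (k : ℕ) :
    Summable fun n => (1 / 2 : ℝ) ^ n * specialScale n ^ k := by
  have h : Summable fun n : ℕ => (n : ℝ) ^ (2 * k) * (1 / 2 : ℝ) ^ n :=
    summable_pow_mul_geometric_of_norm_lt_one _ (by norm_num)
  refine (((summable_nat_add_iff 2).2 h).mul_left (8 ^ k * 4)).congr fun n => ?_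
  unfold specialScale
  push_cast
  rw [mul_pow, ← pow_mul, pow_add]
  ring

theorem contDiff_tsum_rescaled {φ : ℝ → ℝ} (hφ : ContDiff ℝ ∞ φ) (hc : HasCompactSupport φ)
    (a r : ℕ → ℝ) (ha : ∀ n, |a n| ≤ (1 / 2) ^ n) :
    ContDiff ℝ ∞ fun u => ∑' n : ℕ, a n * φ (specialScale n * (u - r n)) := by
  have hbound (k : ℕ) : ∃ C, ∀ x, ‖iteratedDeriv k φ x‖ ≤ C := by
    obtain ⟨C, hC⟩ := (hc.iteratedFDeriv (𝕜 := ℝ) k).exists_bound_of_continuous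
      (hφ.continuous_iteratedFDeriv (m := k) (mod_cast le_top))
    exact ⟨C, fun x => norm_iteratedFDeriv_eq_norm_iteratedDeriv (𝕜 := ℝ) (F := ℝ) ▸ hC x⟩
  choose C hC using hbound
  refine contDiff_tsum (𝕜 := ℝ) (N := (⊤ : ℕ∞))
    (v := fun k n => (1 / 2) ^ n * specialScale n ^ k * C k)
    (fun n => contDiff_const.mul (hφ.comp (by fun_prop)))
    (fun k _ => (summable_geometric_mul_specialScale_pow k).mul_right (C k)) ?_
  intro k n u _
  have hderiv := congr_fun (iteratedDeriv_comp_affine hφ 0 (specialScale n) (r n) k) u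
  simp only [zero_add] at hderiv
  rw [norm_iteratedFDeriv_eq_norm_iteratedDeriv, iteratedDeriv_const_mul_field, hderiv, norm_mul,
    norm_smul, ← mul_assoc, norm_pow, Real.norm_of_nonneg (specialScale_pos n).le]
  have := (specialScale_pos n).le
  gcongr
  exacts [ha n, hC k _]

/-- The times at which the special curves pass through prescribed points. -/
noncomputable def specialTime (n : ℕ) : ℝ := 1 / ((n : ℝ) + 1)

theorem specialTime_mem (n : ℕ) : specialTime n ∈ Icc (0 : ℝ) 1 := by
  unfold specialTime
  exact ⟨by positivity, (div_le_one (by positivity)).2 (by linarith [n.cast_nonneg (α := ℝ)])⟩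

theorem specialTime_sub_of_lt {m n : ℕ} (h : m < n) :
    8 / specialScale m ≤ specialTime m - specialTime n ∧
      8 / specialScale n ≤ specialTime m - specialTime n := by
  unfold specialTime specialScale
  have hm : (0 : ℝ) ≤ m := m.cast_nonneg
  have hmn : (m : ℝ) + 1 ≤ n := by exact_mod_cast h
  have hdiff : 1 / ((m : ℝ) + 1) - 1 / ((n : ℝ) + 1) = (n - m) / ((m + 1) * (n + 1)) := by
    field_simp
    ring
  rw [hdiff]
  constructor <;> rw [div_le_div_iff₀ (by positivity) (by positivity)] <;>
    nlinarith [mul_nonneg hm (sub_nonneg.2 hmn)]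

theorem specialTime_gap {m n : ℕ} (h : m ≠ n) :
    8 / specialScale m ≤ |specialTime m - specialTime n| := by
  rcases h.lt_or_gt with h | h
  · exact (specialTime_sub_of_lt h).1.trans (le_abs_self _)
  · exact abs_sub_comm (specialTime m) _ ▸ (specialTime_sub_of_lt h).2.trans (le_abs_self _)

theorem two_le_specialScale_mul {m n : ℕ} (h : m ≠ n) {u : ℝ}
    (hu : |u - specialTime n| < 1 / specialScale n) :
    2 ≤ specialScale m * |u - specialTime m| := by
  have hm := specialTime_gap h
  have hn := specialTime_gap h.symm
  rw [abs_sub_comm] at hn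
  have htri : |specialTime m - specialTime n| ≤ |u - specialTime m| + |u - specialTime n| :=
    abs_sub_comm u (specialTime m) ▸ abs_sub_le _ _ _
  rw [← div_le_iff₀' (specialScale_pos m)]
  simp only [div_eq_mul_inv] at hm hn hu ⊢
  linarith [inv_pos.2 (specialScale_pos m), inv_pos.2 (specialScale_pos n)]

theorem exists_special_curve (a v : ℕ → ℝ) (ha : ∀ n, |a n| ≤ (1 / 2) ^ n)
    (hv : ∀ n, |v n| ≤ (1 / 2) ^ n) :
    ∃ c : ℝ → ℝ, ContDiff ℝ ∞ c ∧
      ∀ n, ∀ᶠ u in 𝓝 (specialTime n), c u = a n + v n * (u - specialTime n) := by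
  let χ : ContDiffBump (0 : ℝ) := ⟨1, 2, by norm_num, by norm_num⟩
  let x (n : ℕ) (u : ℝ) : ℝ := specialScale n * (u - specialTime n)
  let b (n : ℕ) : ℝ := v n / specialScale n
  have hb (n) : |b n| ≤ (1 / 2) ^ n := by
    rw [abs_div, abs_of_pos (specialScale_pos n)]
    exact (div_le_self (abs_nonneg _) (one_le_specialScale n)).trans (hv n)
  refine ⟨fun u => (∑' n, a n * χ (x n u)) + ∑' n, b n * (x n u * χ (x n u)),
    (contDiff_tsum_rescaled χ.contDiff χ.hasCompactSupport a _ ha).add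
      (contDiff_tsum_rescaled (contDiff_id.mul χ.contDiff) χ.hasCompactSupport.mul_left b _ hb),
    fun n => ?_⟩
  filter_upwards [Metric.ball_mem_nhds (specialTime n) (one_div_pos.2 (specialScale_pos n))]
    with u hu
  rw [Metric.mem_ball, Real.dist_eq] at hu
  have hdist (m) : dist (x m u) 0 = specialScale m * |u - specialTime m| := by
    rw [Real.dist_0_eq_abs, abs_mul, abs_of_pos (specialScale_pos m)]
  have hself : χ (x n u) = 1 := χ.one_of_mem_closedBall <| by
    rw [Metric.mem_closedBall, hdist]
    exact ((lt_div_iff₀' (specialScale_pos n)).1 hu).le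
  have hother (m) (hm : m ≠ n) : χ (x m u) = 0 := χ.zero_of_le_dist <| by
    rw [hdist]
    exact two_le_specialScale_mul hm hu
  rw [tsum_eq_single n fun m hm => by rw [hother m hm, mul_zero],
    tsum_eq_single n fun m hm => by rw [hother m hm, mul_zero, mul_zero], hself, mul_one, mul_one,
    ← mul_assoc, div_mul_cancel₀ _ (specialScale_pos n).ne']

end SpecialCurves

section CurveSmooth

open Filter Topology Set

theorem exists_subseq_dist_le_geometric {α : Type*} [PseudoMetricSpace α] {K : Set α}
    (hK : IsCompact K) {x : ℕ → α} (hx : ∀ n, x n ∈ K) :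
    ∃ (a : α) (φ : ℕ → ℕ), StrictMono φ ∧ ∀ n, dist (x (φ n)) a ≤ (1 / 2) ^ n := by
  obtain ⟨a, -, φ, hφ, hlim⟩ := hK.tendsto_subseq hx
  obtain ⟨ψ, hψ, hfast⟩ := extraction_forall_of_eventually (P := fun n k =>
    dist (x (φ k)) a ≤ (1 / 2 : ℝ) ^ n) fun n =>
      hlim (Metric.closedBall_mem_nhds a (by positivity))
  exact ⟨a, φ ∘ ψ, hφ.comp hψ, hfast⟩

variable {E : Type*} [NormedAddCommGroup E] [NormedSpace ℝ E] {G : ℝ → ℝ → E}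

/-- The function `G` of two real variables is smooth along all smooth curves in the plane. -/
def CurveSmooth (G : ℝ → ℝ → E) : Prop :=
  ∀ σ τ : ℝ → ℝ, ContDiff ℝ ∞ σ → ContDiff ℝ ∞ τ → ContDiff ℝ ∞ fun u => G (σ u) (τ u)

namespace CurveSmooth

theorem swap (hG : CurveSmooth G) : CurveSmooth fun s t => G t s :=
  fun σ τ hσ hτ => hG τ σ hτ hσ

theorem contDiff_left (hG : CurveSmooth G) (t : ℝ) : ContDiff ℝ ∞ fun s => G s t :=
  hG _ _ contDiff_id contDiff_const

/-- A single curve with velocity `(2⁻ⁿ, 0)` at `(s n, t n)` collects all these derivatives. -/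
theorem exists_bound_of_dist_le_geometric (hG : CurveSmooth G) (p : ℕ) {x : ℝ × ℝ} {s t : ℕ → ℝ}
    (hst : ∀ n, dist (s n, t n) x ≤ (1 / 2) ^ n) :
    ∃ C, ∀ n, ((1 / 2) ^ n) ^ p * ‖iteratedDeriv p (fun r => G r (t n)) (s n)‖ ≤ C := by
  simp only [Prod.dist_eq, max_le_iff, Real.dist_eq] at hst
  obtain ⟨σ, hσ, hσ'⟩ := exists_special_curve (fun n => s n - x.1) (fun n => (1 / 2) ^ n)
    (fun n => (hst n).1) (fun n => (abs_of_pos (by positivity)).le)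
  obtain ⟨τ, hτ, hτ'⟩ := exists_special_curve (fun n => t n - x.2) 0 (fun n => (hst n).2)
    (fun n => by simp)
  have hcurve := hG (fun u => x.1 + σ u) (fun u => x.2 + τ u) (contDiff_const.add hσ)
    (contDiff_const.add hτ)
  obtain ⟨C, hC⟩ := isCompact_Icc.exists_bound_of_continuousOn (s := Icc (0 : ℝ) 1)
    (hcurve.continuous_iteratedDeriv p (mod_cast le_top)).continuousOn
  refine ⟨C, fun n => ?_⟩
  have hlocal : (fun u => G (x.1 + σ u) (x.2 + τ u)) =ᶠ[𝓝 (specialTime n)]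
      fun u => G (s n + (1 / 2) ^ n * (u - specialTime n)) (t n) := by
    filter_upwards [hσ' n, hτ' n] with u hσu hτu
    rw [hσu, hτu, Pi.zero_apply]
    ring_nf
  have hderiv := hlocal.iteratedDeriv_eq p
  rw [iteratedDeriv_comp_affine (f := fun r => G r (t n)) (hG.contDiff_left _)] at hderiv
  simpa [hderiv, norm_smul] using hC _ (specialTime_mem n)

theorem hasLocallyBoundedPartials (hG : CurveSmooth G) : HasLocallyBoundedPartials G where
  contDiff := hG.contDiff_left
  exists_bound p R := by
    by_contra! hunbounded
    choose s hs t ht hlarge using fun n : ℕ => hunbounded ((2 ^ n) ^ p * n)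
    obtain ⟨x, φ, hφ, hfast⟩ := exists_subseq_dist_le_geometric
      (isCompact_Icc.prod isCompact_Icc) (x := fun n => (s n, t n))
      fun n => mk_mem_prod (hs n) (ht n)
    obtain ⟨C, hC⟩ := hG.exists_bound_of_dist_le_geometric p hfast
    obtain ⟨n, hn⟩ := exists_nat_gt C
    refine (hC n).not_gt (hn.trans ?_)
    calc (n : ℝ) = ((1 / 2) ^ n) ^ p * ((2 ^ n) ^ p * n) := by
          rw [← mul_assoc, ← mul_pow, ← mul_pow]
          norm_num
      _ ≤ ((1 / 2) ^ n) ^ p * ((2 ^ φ n) ^ p * φ n) := by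
          gcongr
          exacts [one_le_two, hφ.le_apply, hφ.le_apply]
      _ < _ := by
          gcongr
          exact hlarge (φ n)

end CurveSmooth

/-- Boman's theorem in the plane. -/
theorem CurveSmooth.contDiff_uncurry {G : ℝ → ℝ → ℝ} (hG : CurveSmooth G) :
    ContDiff ℝ ∞ (Function.uncurry G) :=
  hG.hasLocallyBoundedPartials.contDiff_uncurry_real hG.swap.hasLocallyBoundedPartials

end CurveSmooth

section ExponentialLaw

open Filter Topology Set

theorem iteratedDeriv_eq_of_hasDerivAt_succ {E : Type*} [NormedAddCommGroup E] [NormedSpace ℝ E]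
    {F : ℕ → ℝ → E} (h : ∀ q t, HasDerivAt (F q) (F (q + 1) t) t) (q : ℕ) :
    iteratedDeriv q (F 0) = F q := by
  induction q with
  | zero => exact iteratedDeriv_zero
  | succ q ih => rw [iteratedDeriv_succ, ih, funext fun t => (h q t).deriv]

theorem contDiff_of_hasDerivAt_succ {E : Type*} [NormedAddCommGroup E] [NormedSpace ℝ E]
    {F : ℕ → ℝ → E} (h : ∀ q t, HasDerivAt (F q) (F (q + 1) t) t) : ContDiff ℝ ∞ (F 0) :=
  contDiff_of_differentiable_iteratedDeriv fun q _ => by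
    rw [iteratedDeriv_eq_of_hasDerivAt_succ h]
    exact fun t => (h q t).differentiableAt

section ScalarwiseSmooth

variable {B : Type*} [NormedAddCommGroup B] [NormedSpace ℝ B] {x : ℝ → B}

theorem exists_clm_apply_eq_iteratedDeriv
    (hx : ∀ l : StrongDual ℝ B, ContDiff ℝ ∞ fun t => l (x t)) (q : ℕ) (t : ℝ) :
    ∃ S : StrongDual ℝ B →L[ℝ] ℝ, ∀ l, S l = iteratedDeriv q (fun t => l (x t)) t := by
  induction q generalizing t with
  | zero => exact ⟨NormedSpace.inclusionInDoubleDual ℝ B (x t), fun l => by simp⟩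
  | succ q ih =>
    choose S hS using ih
    have hderiv (l) :
        HasDerivAt (fun t => S t l) (iteratedDeriv (q + 1) (fun t => l (x t)) t) t := by
      simp only [hS, iteratedDeriv_succ]
      exact ((hx l).differentiable_iteratedDeriv q (mod_cast WithTop.coe_lt_top _) t).hasDerivAt
    have hlim : Tendsto (fun (n : ℕ) (l : StrongDual ℝ B) =>
        ((n + 1 : ℝ) • (S (t + 1 / (n + 1)) - S t)) l) atTop
        (𝓝 fun l => iteratedDeriv (q + 1) (fun t => l (x t)) t) := by
      refine tendsto_pi_nhds.2 fun l => ?_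
      have hstep : Tendsto (fun n : ℕ => (1 : ℝ) / (n + 1)) atTop (𝓝[≠] 0) :=
        tendsto_nhdsWithin_iff.2 ⟨tendsto_one_div_add_atTop_nhds_zero_nat,
          .of_forall fun n => Nat.one_div_pos_of_nat.ne'⟩
      refine ((hderiv l).tendsto_slope_zero.comp hstep).congr fun n => ?_
      simp
    exact ⟨continuousLinearMapOfTendsto _ hlim, fun l => rfl⟩

theorem exists_bound_iteratedDeriv_dual
    (hx : ∀ l : StrongDual ℝ B, ContDiff ℝ ∞ fun t => l (x t)) (q : ℕ) (R : ℝ) :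
    ∃ C, ∀ t ∈ Icc (-R) R, ∀ l : StrongDual ℝ B,
      ‖iteratedDeriv q (fun t => l (x t)) t‖ ≤ C * ‖l‖ := by
  choose S hS using exists_clm_apply_eq_iteratedDeriv hx q
  obtain ⟨C, hC⟩ := banach_steinhaus (g := fun t : Icc (-R) R => S t) fun l => by
    obtain ⟨C, hC⟩ := isCompact_Icc.exists_bound_of_continuousOn (s := Icc (-R) R)
      ((hx l).continuous_iteratedDeriv q (mod_cast le_top)).continuousOn
    exact ⟨C, fun t => (congr_arg _ (hS t l)).trans_le (hC t t.2)⟩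
  exact ⟨C, fun t ht l => hS t l ▸ (S t).le_of_opNorm_le (hC ⟨t, ht⟩) l⟩

end ScalarwiseSmooth

section PartialDerivatives

variable {H : ℝ → ℝ → ℝ}

theorem contDiff_uncurry_iteratedDeriv_left (hH : ContDiff ℝ ∞ (Function.uncurry H)) (p : ℕ) :
    ContDiff ℝ ∞ (Function.uncurry fun s t => iteratedDeriv p (fun s => H s t) s) := by
  induction p with
  | zero => simpa only [iteratedDeriv_zero] using hH
  | succ p ih =>
    have hfderiv (x : ℝ × ℝ) : iteratedDeriv (p + 1) (fun s => H s x.2) x.1 =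
        fderiv ℝ (Function.uncurry fun s t => iteratedDeriv p (fun s => H s t) s) x (1, 0) := by
      have hpath : HasDerivAt (fun s : ℝ => (s, x.2)) (1, 0) x.1 :=
        (hasDerivAt_id x.1).prodMk (hasDerivAt_const x.1 x.2)
      rw [iteratedDeriv_succ]
      exact ((ih.differentiable (by simp) x).hasFDerivAt.comp_hasDerivAt x.1 hpath).deriv
    rw [Function.uncurry_def, funext hfderiv]
    exact (ih.fderiv_right (m := ∞) (mod_cast le_top)).clm_apply contDiff_const

theorem contDiff_uncurry_iteratedDeriv_right (hH : ContDiff ℝ ∞ (Function.uncurry H)) (q : ℕ) :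
    ContDiff ℝ ∞ (Function.uncurry fun s t => iteratedDeriv q (H s) t) :=
  (contDiff_uncurry_iteratedDeriv_left (H := fun t s => H s t)
    (hH.comp (contDiff_snd.prodMk contDiff_fst)) q).comp (contDiff_snd.prodMk contDiff_fst)

end PartialDerivatives

/-- The slice `g · y` as an element of the Banach space of continuous functions on `[-R, R]`. -/
def restrictIcc {Y : Type*} (R : ℝ) (g : ℝ → Y → ℝ) (hg : ∀ y, Continuous fun s => g s y) (y : Y) :
    C(Icc (-R) R, ℝ) :=
  ⟨fun s => g s y, (hg y).comp continuous_subtype_val⟩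

theorem continuous_restrictIcc {R : ℝ} {H : ℝ → ℝ → ℝ} (hH : Continuous (Function.uncurry H)) :
    Continuous (restrictIcc R H fun t => hH.comp (.prodMk_left t)) :=
  ContinuousMap.continuous_of_continuous_uncurry _ <|
    hH.comp ((continuous_subtype_val.comp continuous_snd).prodMk continuous_fst)

theorem hasDerivAt_restrictIcc {R : ℝ} {H H' : ℝ → ℝ → ℝ} (hH : Continuous (Function.uncurry H))
    (hH' : Continuous (Function.uncurry H')) (hderiv : ∀ s t, HasDerivAt (H s) (H' s t) t) (t : ℝ) :
    HasDerivAt (restrictIcc R H fun t => hH.comp (.prodMk_left t))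
      (restrictIcc R H' (fun t => hH'.comp (.prodMk_left t)) t) t := by
  set x := restrictIcc R H fun t => hH.comp (.prodMk_left t)
  set x' := restrictIcc R H' fun t => hH'.comp (.prodMk_left t)
  have hx' : Continuous x' := continuous_restrictIcc hH'
  have hprimitive : x = fun t => x 0 + ∫ r in (0)..t, x' r := by
    ext t s
    have hFTC : ∫ r in (0)..t, H' s r = H s t - H s 0 :=
      intervalIntegral.integral_eq_sub_of_hasDerivAt (fun r _ => hderiv s r)
        ((hH'.comp (.prodMk_right (s : ℝ))).intervalIntegrable _ _)
    have heval := (ContinuousMap.evalCLM ℝ s).intervalIntegral_comp_comm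
      (hx'.intervalIntegrable (μ := MeasureTheory.volume) 0 t)
    exact (eq_add_of_sub_eq' (heval.symm.trans hFTC).symm)
  rw [hprimitive]
  exact (hx'.integral_hasStrictDerivAt 0 t).hasDerivAt.const_add (x 0)

theorem contDiff_restrictIcc {R : ℝ} {H : ℝ → ℝ → ℝ} (hH : ContDiff ℝ ∞ (Function.uncurry H)) :
    ContDiff ℝ ∞ (restrictIcc R H fun t => hH.continuous.comp (.prodMk_left t)) := by
  have hcont (q : ℕ) := (contDiff_uncurry_iteratedDeriv_right hH q).continuous
  have hslice (s) : ContDiff ℝ ∞ (H s) := hH.comp (contDiff_prodMk_right s)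
  refine contDiff_of_hasDerivAt_succ
    (F := fun q => restrictIcc R (fun s t => iteratedDeriv q (H s) t)
      fun t => (hcont q).comp (.prodMk_left t))
    fun q t => hasDerivAt_restrictIcc (hcont q) (hcont (q + 1)) (fun s t => ?_) t
  rw [iteratedDeriv_succ]
  exact ((hslice s).differentiable_iteratedDeriv q (mod_cast WithTop.coe_lt_top _) t).hasDerivAt

variable {Y : Type*} {C₀ : Set (ℝ → Y)} {g : ℝ → Y → ℝ} {d : ℝ → Y}

theorem exists_bound_iteratedDeriv_comp (hg' : ∀ y, ContDiff ℝ ∞ fun s => g s y)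
    (hg : ∀ c ∈ C₀, CurveSmooth fun s t => g s (c t))
    (hd : ∀ f : Y → ℝ, (∀ c ∈ C₀, ContDiff ℝ ∞ (f ∘ c)) → ContDiff ℝ ∞ (f ∘ d)) (p q : ℕ) (R : ℝ) :
    ∃ C, ∀ s ∈ Icc (-R) R, ∀ t ∈ Icc (-R) R,
      ‖iteratedDeriv q (fun t => iteratedDeriv p (fun s => g s (d t)) s) t‖ ≤ C := by
  let z : Y → C(Icc (-R) R, ℝ) := restrictIcc R (fun s y => iteratedDeriv p (fun s => g s y) s)
    fun y => (hg' y).continuous_iteratedDeriv p (mod_cast le_top)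
  have hz (l : StrongDual ℝ C(Icc (-R) R, ℝ)) : ContDiff ℝ ∞ fun t => l (z (d t)) :=
    hd (fun y => l (z y)) fun c hc => l.contDiff.comp <|
      contDiff_restrictIcc (contDiff_uncurry_iteratedDeriv_left (hg c hc).contDiff_uncurry p)
  obtain ⟨C, hC⟩ := exists_bound_iteratedDeriv_dual hz q R
  refine ⟨|C|, fun s hs t ht => ?_⟩
  let δ : StrongDual ℝ C(Icc (-R) R, ℝ) := ContinuousMap.evalCLM ℝ ⟨s, hs⟩
  have hδ : ‖δ‖ ≤ 1 := δ.opNorm_le_bound zero_le_one fun f => by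
    simpa [δ] using f.norm_coe_le_norm ⟨s, hs⟩
  calc _ ≤ C * ‖δ‖ := hC t ht δ
    _ ≤ |C| * 1 := by gcongr; exact le_abs_self C
    _ = |C| := mul_one _

/-- The curve `d` belongs to the Frölicher structure generated by `C₀`. The slices of `g`, as
elements of `C([-R, R])`, form a scalarwise smooth curve along `d`, and the uniform boundedness
principle then bounds the partial derivatives of the composite, as Boman's theorem needs. -/
theorem contDiff_uncurry_comp (hcov : ∀ y, ∃ c ∈ C₀, ∃ t, c t = y)
    (hg : ∀ c ∈ C₀, CurveSmooth fun s t => g s (c t))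
    (hd : ∀ f : Y → ℝ, (∀ c ∈ C₀, ContDiff ℝ ∞ (f ∘ c)) → ContDiff ℝ ∞ (f ∘ d)) :
    ContDiff ℝ ∞ (Function.uncurry fun s t => g s (d t)) := by
  have hleft (y) : ContDiff ℝ ∞ fun s => g s y := by
    obtain ⟨c, hc, t, rfl⟩ := hcov y
    exact (hg c hc).contDiff_left t
  have hright (s) : ContDiff ℝ ∞ fun t => g s (d t) :=
    hd (g s) fun c hc => (hg c hc).swap.contDiff_left s
  refine HasLocallyBoundedPartials.contDiff_uncurry_real ⟨fun t => hleft (d t), fun p R => ?_⟩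
    ⟨hright, fun q R => ?_⟩
  · simpa using exists_bound_iteratedDeriv_comp hleft hg hd p 0 R
  · obtain ⟨C, hC⟩ := exists_bound_iteratedDeriv_comp hleft hg hd 0 q R
    exact ⟨C, fun t ht s hs => by simpa using hC s hs t ht⟩

end ExponentialLaw

section FrolicherBasics

attribute [fun_prop] FrlSmooth FrlSmooth.id FrlSmooth.const FrlSmooth.comp FrlSmooth.fst
  FrlSmooth.snd FrlSmooth.prodMk FrlSmooth.symm PointedFrl.Hom.smooth PointedFrl.suspMk_smooth

theorem FrolicherSpace.const_mem_curves {X : Type u} [FrolicherSpace X] (x : X) :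
    (fun _ => x) ∈ curves (X := X) :=
  (mem_curves_iff _).2 fun _ _ => contDiff_const

namespace FrlSmooth

variable {X : Type u} {Y : Type v} {Z : Type w} {W : Type x}
variable [FrolicherSpace X] [FrolicherSpace Y] [FrolicherSpace Z] [FrolicherSpace W]

theorem of_mem_curves {c : ℝ → X} (hc : c ∈ curves (X := X)) : FrlSmooth c :=
  fun f hf => (mem_curves_iff c).1 hc f hf

theorem mem_curves {c : ℝ → X} (hc : FrlSmooth c) : c ∈ curves (X := X) :=
  iff_curves.1 hc _ (contDiff_id : ContDiff ℝ ∞ (_root_.id : ℝ → ℝ))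

theorem of_contDiff {φ : ℝ → ℝ} (hφ : ContDiff ℝ ∞ φ) : FrlSmooth φ :=
  of_mem_curves hφ

theorem contDiff {φ : ℝ → ℝ} (hφ : FrlSmooth φ) : ContDiff ℝ ∞ φ :=
  hφ.mem_curves

theorem iff_mem_functions {f : X → ℝ} : FrlSmooth f ↔ f ∈ functions (X := X) :=
  ⟨fun hf => hf _ (contDiff_id : ContDiff ℝ ∞ (_root_.id : ℝ → ℝ)),
    fun hf => iff_curves.2 fun c hc => (mem_functions_iff f).1 hf c hc⟩

@[fun_prop]
theorem unitInterval_val : FrlSmooth (fun t : unitInterval => (t : ℝ)) :=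
  iff_curves.2 fun _ hc => mem_curves_unitInterval.1 hc

theorem unitInterval_mk {φ : X → unitInterval} (hφ : FrlSmooth fun x => (φ x : ℝ)) : FrlSmooth φ :=
  iff_curves.2 fun c hc => mem_curves_unitInterval.2 (iff_curves.1 hφ c hc)

@[fun_prop]
theorem mul {φ ψ : X → unitInterval} (hφ : FrlSmooth φ) (hψ : FrlSmooth ψ) :
    FrlSmooth fun x => φ x * ψ x :=
  iff_curves.2 fun c hc => mem_curves_unitInterval.2 <|
    (mem_curves_unitInterval.1 (iff_curves.1 hφ c hc)).mul
      (mem_curves_unitInterval.1 (iff_curves.1 hψ c hc))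

@[fun_prop]
theorem convexComb {φ ψ s : X → unitInterval} (hφ : FrlSmooth φ) (hψ : FrlSmooth ψ)
    (hs : FrlSmooth s) : FrlSmooth fun x => Set.Icc.convexComb (φ x) (ψ x) (s x) :=
  iff_curves.2 fun c hc => mem_curves_unitInterval.2 <| by
    have h {χ : X → unitInterval} (hχ : FrlSmooth χ) : ContDiff ℝ ∞ fun r => (χ (c r) : ℝ) :=
      mem_curves_unitInterval.1 (iff_curves.1 hχ c hc)
    exact ((contDiff_const.sub (h hs)).mul (h hφ)).add ((h hs).mul (h hψ))

theorem of_generating {C₀ : Set (ℝ → Y)} (hcov : ∀ y, ∃ c ∈ C₀, ∃ t, c t = y)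
    (hgen : ∀ f : Y → ℝ, (∀ c ∈ C₀, ContDiff ℝ ∞ (f ∘ c)) → f ∈ functions (X := Y))
    {g : Z × Y → W} (hg : ∀ c ∈ C₀, FrlSmooth fun p : Z × ℝ => g (p.1, c p.2)) : FrlSmooth g := by
  refine fun e he => (mem_functions_iff _).2 fun γ hγ => ?_
  have hγ₁ : FrlSmooth fun s => (γ s).1 := fst.comp (of_mem_curves hγ)
  have hγ₂ : FrlSmooth fun s => (γ s).2 := snd.comp (of_mem_curves hγ)
  have he : FrlSmooth e := iff_mem_functions.2 he
  have key : ContDiff ℝ ∞ (Function.uncurry fun s t => e (g ((γ s).1, (γ t).2))) := by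
    refine contDiff_uncurry_comp (g := fun s y => e (g ((γ s).1, y))) hcov ?_
      fun f hf => iff_curves.1 (iff_mem_functions.2 (hgen f hf)) _ hγ₂.mem_curves
    intro c hc σ τ hσ hτ
    exact (he.comp <| (hg c hc).comp <|
      (hγ₁.comp (of_contDiff hσ)).prodMk (of_contDiff hτ)).contDiff
  exact key.comp (contDiff_id.prodMk contDiff_id)

theorem of_prod_quot {r : X → X → Prop} {g : Z × Quot r → W}
    (hg : FrlSmooth fun p : Z × X => g (p.1, Quot.mk r p.2)) : FrlSmooth g := by
  refine of_generating (C₀ := {d | ∃ c ∈ curves (X := X), d = Quot.mk r ∘ c}) ?_ (fun _ hf => hf) ?_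
  · rintro ⟨x⟩
    exact ⟨_, ⟨_, const_mem_curves x, rfl⟩, 0, rfl⟩
  · rintro _ ⟨c, hc, rfl⟩
    exact hg.comp (fst.prodMk ((of_mem_curves hc).comp snd))

theorem of_prod_sum {g : Z × (X ⊕ Y) → W} (hl : FrlSmooth fun p : Z × X => g (p.1, Sum.inl p.2))
    (hr : FrlSmooth fun p : Z × Y => g (p.1, Sum.inr p.2)) : FrlSmooth g := by
  refine of_generating (C₀ := {d | ∃ c ∈ curves (X := X), d = Sum.inl ∘ c} ∪
    {d | ∃ c ∈ curves (X := Y), d = Sum.inr ∘ c}) ?_ (fun _ hf => hf) ?_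
  · rintro (x | y)
    · exact ⟨_, Or.inl ⟨_, const_mem_curves x, rfl⟩, 0, rfl⟩
    · exact ⟨_, Or.inr ⟨_, const_mem_curves y, rfl⟩, 0, rfl⟩
  · rintro _ (⟨c, hc, rfl⟩ | ⟨c, hc, rfl⟩)
    · exact hl.comp (fst.prodMk ((of_mem_curves hc).comp snd))
    · exact hr.comp (fst.prodMk ((of_mem_curves hc).comp snd))

theorem glue {ρ : Z → ℝ} (hρ : FrlSmooth ρ) {χ φ ψ : Z → W} (hφ : FrlSmooth φ) (hψ : FrlSmooth ψ)
    {a b : ℝ} (hab : a < b) (hχφ : ∀ z, ρ z < b → χ z = φ z) (hχψ : ∀ z, a < ρ z → χ z = ψ z) :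
    FrlSmooth χ := by
  refine fun e he => (mem_functions_iff _).2 fun c hc => contDiff_iff_contDiffAt.2 fun s => ?_
  have hρc : Continuous (ρ ∘ c) := ContDiff.continuous (𝕜 := ℝ) (n := ∞) (iff_curves.1 hρ c hc)
  rcases lt_or_ge (ρ (c s)) b with hs | hs
  · refine ((mem_functions_iff _).1 (hφ e he) c hc).contDiffAt.congr_of_eventuallyEq ?_
    filter_upwards [hρc.continuousAt.eventually_lt continuousAt_const hs] with r hr
    exact congrArg e (hχφ _ hr)
  · refine ((mem_functions_iff _).1 (hψ e he) c hc).contDiffAt.congr_of_eventuallyEq ?_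
    filter_upwards [continuousAt_const.eventually_lt hρc.continuousAt (hab.trans_le hs)] with r hr
    exact congrArg e (hχψ _ hr)

end FrlSmooth

end FrolicherBasics

/-- A smooth step of the unit interval, which is `0` on `[0, a]` and `1` on `[b, 1]` when
`a < b`. -/
noncomputable def smoothStep (a b : ℝ) (t : unitInterval) : unitInterval :=
  ⟨Real.smoothTransition ((t - a) / (b - a)), Real.smoothTransition.nonneg _,
    Real.smoothTransition.le_one _⟩

section SmoothStep

variable {a b : ℝ} {t : unitInterval}

theorem smoothStep_eq_zero (hab : a < b) (ht : t ≤ a) : smoothStep a b t = 0 :=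
  Subtype.ext <| Real.smoothTransition.zero_of_nonpos <|
    div_nonpos_of_nonpos_of_nonneg (sub_nonpos.2 ht) (sub_nonneg.2 hab.le)

theorem smoothStep_eq_one (hab : a < b) (ht : b ≤ t) : smoothStep a b t = 1 :=
  Subtype.ext <| Real.smoothTransition.one_of_one_le <|
    (one_le_div (sub_pos.2 hab)).2 (sub_le_sub_right ht a)

theorem smoothStep_zero (ha : 0 ≤ a) (hab : a < b) : smoothStep a b 0 = 0 :=
  smoothStep_eq_zero hab ha

theorem smoothStep_one (hab : a < b) (hb : b ≤ 1) : smoothStep a b 1 = 1 :=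
  smoothStep_eq_one hab hb

@[fun_prop]
theorem smooth_smoothStep : FrlSmooth (smoothStep a b) := by
  have h : ContDiff ℝ ∞ fun t => Real.smoothTransition ((t - a) / (b - a)) :=
    Real.smoothTransition.contDiff.comp ((contDiff_id.sub contDiff_const).div_const _)
  exact FrlSmooth.unitInterval_mk ((FrlSmooth.of_contDiff h).comp FrlSmooth.unitInterval_val)

end SmoothStep

namespace FlatInterval

open unitInterval

/-- The identity from the usual to the flattened unit interval. -/
def ofUnit (t : unitInterval) : FlatInterval := t

/-- The underlying point of the usual unit interval. This map is not smooth. -/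
def toUnit (t : FlatInterval) : unitInterval := t

@[simp] theorem ofUnit_toUnit (t : FlatInterval) : ofUnit (toUnit t) = t := rfl
@[simp] theorem toUnit_ofUnit (t : unitInterval) : toUnit (ofUnit t) = t := rfl
@[simp] theorem toUnit_zero : toUnit zero = 0 := rfl
@[simp] theorem toUnit_one : toUnit one = 1 := rfl
@[simp] theorem ofUnit_zero : ofUnit 0 = zero := rfl
@[simp] theorem ofUnit_one : ofUnit 1 = one := rfl

theorem smooth_of_generators {X : Type u} [FrolicherSpace X] {φ : X → FlatInterval}
    (h : ∀ f : unitInterval → ℝ, FrlSmooth f → ∀ ε : ℝ, 0 < ε → ε < 1 / 4 →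
      (∀ t : unitInterval, (t : ℝ) < ε → f t = f 0) →
      (∀ t : unitInterval, 1 - ε < (t : ℝ) → f t = f 1) →
      FrlSmooth fun x => f (toUnit (φ x))) : FrlSmooth φ := by
  rw [FrlSmooth.iff_curves]
  rintro c hc f ⟨hf, ε, hε, hε', hf₀, hf₁⟩
  exact FrlSmooth.iff_curves.1
    (h f (FrlSmooth.iff_mem_functions.2 hf) ε hε hε' hf₀ hf₁) c hc

@[fun_prop]
theorem smooth_ofUnit : FrlSmooth ofUnit :=
  smooth_of_generators fun _ hf _ _ _ _ _ => hf

theorem smooth_of_flat {X : Type u} [FrolicherSpace X] {φ : FlatInterval → X}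
    (hφ : FrlSmooth fun t => φ (ofUnit t)) {ε : ℝ} (hε : 0 < ε)
    (h₀ : ∀ t, (toUnit t : ℝ) < ε → φ t = φ zero)
    (h₁ : ∀ t, 1 - ε < (toUnit t : ℝ) → φ t = φ one) : FrlSmooth φ := by
  intro f hf c hc
  refine hc (fun t => f (φ (ofUnit t)))
    ⟨hφ f hf, min ε (1 / 5), by positivity, ?_, fun t ht => ?_, fun t ht => ?_⟩
  · exact (min_le_right _ _).trans_lt (by norm_num)
  · exact congrArg f (h₀ t (ht.trans_le (min_le_left _ _)))
  · exact congrArg f (h₁ t ((sub_le_sub_left (min_le_left _ _) _).trans_lt ht))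

/-- A reparametrization of the flattened interval that is constant on `[0, a]` and on `[b, 1]`. -/
noncomputable def brake (a b : ℝ) (t : FlatInterval) : unitInterval :=
  smoothStep a b (toUnit t)

section Brake

variable {a b : ℝ} {t : FlatInterval}

theorem brake_eq_zero (hab : a < b) (ht : (toUnit t : ℝ) ≤ a) : brake a b t = 0 :=
  smoothStep_eq_zero hab ht

theorem brake_eq_one (hab : a < b) (ht : b ≤ (toUnit t : ℝ)) : brake a b t = 1 :=
  smoothStep_eq_one hab ht

theorem brake_zero (ha : 0 < a) (hab : a < b) : brake a b zero = 0 :=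
  smoothStep_zero ha.le hab

theorem brake_one (hab : a < b) (hb : b < 1) : brake a b one = 1 :=
  smoothStep_one hab hb.le

@[fun_prop]
theorem smooth_brake (ha : 0 < a) (hab : a < b) (hb : b < 1) : FrlSmooth (brake a b) := by
  refine smooth_of_flat (smooth_smoothStep (a := a) (b := b)) (ε := min a (1 - b))
    (lt_min ha (sub_pos.2 hb)) (fun t ht => ?_) fun t ht => ?_
  · rw [brake_eq_zero hab (ht.le.trans (min_le_left _ _)), brake_zero ha hab]
  · rw [brake_eq_one hab (by linarith [min_le_right a (1 - b)]), brake_one hab hb]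

theorem smooth_ite {Z : Type u} {W : Type v} [FrolicherSpace Z] [FrolicherSpace W]
    {τ : Z → FlatInterval} (hτ : FrlSmooth τ) {φ ψ : Z → W} (hφ : FrlSmooth φ) (hψ : FrlSmooth ψ)
    {c : ℝ} (ha : 0 < a) (hac : a < c) (hcb : c < b) (hb : b < 1)
    (h : ∀ z, a ≤ toUnit (τ z) → toUnit (τ z) ≤ b → φ z = ψ z) :
    FrlSmooth fun z => if (toUnit (τ z) : ℝ) ≤ c then φ z else ψ z := by
  have hab := hac.trans hcb
  have hρ : FrlSmooth fun z => (brake a b (τ z) : ℝ) :=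
    FrlSmooth.unitInterval_val.comp ((smooth_brake ha hab hb).comp hτ)
  refine FrlSmooth.glue hρ hφ hψ zero_lt_one (fun z hz => ?_) fun z hz => ?_
  · have hzb : (toUnit (τ z) : ℝ) < b := by
      contrapose! hz
      rw [brake_eq_one hab hz, Set.Icc.coe_one]
    split_ifs with hzc
    · rfl
    · exact (h z (hac.le.trans (not_le.1 hzc).le) hzb.le).symm
  · have haz : a < toUnit (τ z) := by
      contrapose! hz
      rw [brake_eq_zero hab hz, Set.Icc.coe_zero]
    split_ifs with hzc
    · exact h z haz.le (hzc.trans hcb.le)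
    · rfl

end Brake

/-- A reparametrization of the flattened interval that is constant near the endpoints and is the
identity on `[ε, 1 - ε]`. -/
noncomputable def clamp (ε : ℝ) (t : FlatInterval) : unitInterval :=
  smoothStep (ε / 2) ε (toUnit t) * σ (smoothStep (ε / 2) ε (σ (toUnit t)) * σ (toUnit t))

section Clamp

variable {ε : ℝ} {t : FlatInterval}

theorem clamp_of_le_half (hε : 0 < ε) (hε' : ε < 1 / 2) (ht : (toUnit t : ℝ) ≤ 1 / 2) :
    clamp ε t = smoothStep (ε / 2) ε (toUnit t) * toUnit t := by
  have hσ : smoothStep (ε / 2) ε (σ (toUnit t)) = 1 :=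
    smoothStep_eq_one (half_lt_self hε) (by rw [coe_symm_eq]; linarith)
  rw [clamp, hσ, one_mul, symm_symm]

theorem clamp_of_half_le (hε : 0 < ε) (hε' : ε < 1 / 2) (ht : 1 / 2 ≤ (toUnit t : ℝ)) :
    clamp ε t = σ (smoothStep (ε / 2) ε (σ (toUnit t)) * σ (toUnit t)) := by
  rw [clamp, smoothStep_eq_one (t := toUnit t) (half_lt_self hε) (hε'.le.trans ht), one_mul]

theorem clamp_eq_toUnit (hε : 0 < ε) (hε' : ε < 1 / 2) (h₀ : ε ≤ toUnit t)
    (h₁ : toUnit t ≤ 1 - ε) : clamp ε t = toUnit t := by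
  rcases le_total (toUnit t : ℝ) (1 / 2) with ht | ht
  · rw [clamp_of_le_half hε hε' ht, smoothStep_eq_one (half_lt_self hε) h₀, one_mul]
  · rw [clamp_of_half_le hε hε' ht,
      smoothStep_eq_one (half_lt_self hε) (by rw [coe_symm_eq]; linarith), one_mul, symm_symm]

theorem clamp_lt (hε : 0 < ε) (hε' : ε < 1 / 2) (ht : toUnit t < ε) : clamp ε t < ε := by
  rw [clamp_of_le_half hε hε' (by linarith)]
  exact lt_of_le_of_lt mul_le_right ht

theorem lt_clamp (hε : 0 < ε) (hε' : ε < 1 / 2) (ht : 1 - ε < toUnit t) : 1 - ε < clamp ε t := by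
  rw [clamp_of_half_le hε hε' (by linarith)]
  exact ht.trans_le (le_symm_comm.1 mul_le_right)

@[fun_prop]
theorem smooth_clamp (hε : 0 < ε) (hε' : ε < 1 / 2) : FrlSmooth (clamp ε) := by
  refine smooth_of_flat (by unfold clamp; simp only [toUnit_ofUnit]; fun_prop) (half_pos hε)
    (fun t ht => ?_) fun t ht => ?_
  · rw [clamp_of_le_half hε hε' (by linarith), clamp_of_le_half hε hε' (by simp),
      smoothStep_eq_zero (half_lt_self hε) ht.le, zero_mul, toUnit_zero, mul_zero]
  · rw [clamp_of_half_le hε hε' (by linarith), clamp_of_half_le hε hε' (by norm_num),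
      smoothStep_eq_zero (half_lt_self hε) (by rw [coe_symm_eq]; linarith), zero_mul, toUnit_one,
      symm_one, mul_zero]

end Clamp

theorem coe_convexComb_lt {x y : unitInterval} {c : ℝ} (hx : x < c) (hy : y < c)
    (s : unitInterval) : Set.Icc.convexComb x y s < c :=
  convex_Iio c hx hy (one_minus_nonneg s) s.2.1 (sub_add_cancel _ _)

theorem lt_coe_convexComb {x y : unitInterval} {c : ℝ} (hx : c < x) (hy : c < y)
    (s : unitInterval) : c < Set.Icc.convexComb x y s :=
  convex_Ioi c hx hy (one_minus_nonneg s) s.2.1 (sub_add_cancel _ _)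

/-- The identity can be replaced by `clamp` because the generating functions do not see the
difference. -/
theorem smooth_convexComb_toUnit {φ : FlatInterval → unitInterval} (hφ : FrlSmooth φ) {δ : ℝ}
    (hδ : 0 < δ) (h₀ : ∀ t, (toUnit t : ℝ) < δ → φ t = 0)
    (h₁ : ∀ t, 1 - δ < (toUnit t : ℝ) → φ t = 1) :
    FrlSmooth fun p : unitInterval × FlatInterval =>
      ofUnit (Set.Icc.convexComb (toUnit p.2) (φ p.2) p.1) := by
  refine smooth_of_generators fun f hf ε hε hε' hf₀ hf₁ => ?_
  obtain ⟨η, hη, hηδ, hηε⟩ : ∃ η, 0 < η ∧ η ≤ δ ∧ η ≤ ε :=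
    ⟨min δ ε, lt_min hδ hε, min_le_left _ _, min_le_right _ _⟩
  have hη' : η < 1 / 2 := by linarith
  have hclamp (s : unitInterval) (t : FlatInterval) : f (Set.Icc.convexComb (toUnit t) (φ t) s) =
      f (Set.Icc.convexComb (clamp η t) (φ t) s) := by
    rcases lt_or_ge (toUnit t : ℝ) η with ht | ht₀
    · have hφt : φ t < η := by simpa [h₀ t (ht.trans_le hηδ)] using hη
      rw [hf₀ _ ((coe_convexComb_lt ht hφt s).trans_le hηε),
        hf₀ _ ((coe_convexComb_lt (clamp_lt hη hη' ht) hφt s).trans_le hηε)]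
    rcases lt_or_ge (1 - η) (toUnit t : ℝ) with ht | ht₁
    · have hφt : 1 - η < φ t := by simpa [h₁ t (by linarith)] using hη
      rw [hf₁ _ ((sub_le_sub_left hηε 1).trans_lt (lt_coe_convexComb ht hφt s)),
        hf₁ _ ((sub_le_sub_left hηε 1).trans_lt (lt_coe_convexComb (lt_clamp hη hη' ht) hφt s))]
    · rw [clamp_eq_toUnit hη hη' ht₀ ht₁]
  change FrlSmooth fun p : unitInterval × FlatInterval =>
    f (Set.Icc.convexComb (toUnit p.2) (φ p.2) p.1)
  simp only [hclamp]
  fun_prop (disch := assumption)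

/-- The linear homotopy from the identity of the flattened interval to `brake a b`. -/
noncomputable def brakeHomotopy (a b : ℝ) (s : unitInterval) (t : FlatInterval) : FlatInterval :=
  ofUnit (Set.Icc.convexComb (toUnit t) (brake a b t) s)

section BrakeHomotopy

variable {a b : ℝ}

@[simp]
theorem brakeHomotopy_zero_left (t : FlatInterval) : brakeHomotopy a b 0 t = t := by
  simp [brakeHomotopy]

@[simp]
theorem brakeHomotopy_one_left (t : FlatInterval) :
    brakeHomotopy a b 1 t = ofUnit (brake a b t) := by
  simp [brakeHomotopy]

theorem brakeHomotopy_zero (ha : 0 < a) (hab : a < b) (s : unitInterval) :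
    brakeHomotopy a b s zero = zero := by
  simp [brakeHomotopy, brake_zero ha hab]

theorem brakeHomotopy_one (hab : a < b) (hb : b < 1) (s : unitInterval) :
    brakeHomotopy a b s one = one := by
  simp [brakeHomotopy, brake_one hab hb]

@[fun_prop]
theorem smooth_brakeHomotopy (ha : 0 < a) (hab : a < b) (hb : b < 1) :
    FrlSmooth fun p : unitInterval × FlatInterval => brakeHomotopy a b p.1 p.2 :=
  smooth_convexComb_toUnit (smooth_brake ha hab hb) (δ := min a (1 - b))
    (lt_min ha (sub_pos.2 hb)) (fun _ ht => brake_eq_zero hab (ht.le.trans (min_le_left _ _)))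
    fun _ ht => brake_eq_one hab (by linarith [min_le_right a (1 - b)])

end BrakeHomotopy

end FlatInterval

namespace PointedFrl

section Homotopic

variable {X : PointedFrl.{u}} {Y : PointedFrl.{v}} {Z : PointedFrl.{w}}

theorem Homotopic.comp_left {f g : Hom X Y} (h : Homotopic f g) (k : Hom Y Z) :
    Homotopic (k.comp f) (k.comp g) := by
  obtain ⟨H, hH, hpt, h₀, h₁⟩ := h
  exact ⟨fun p => k (H p), k.smooth.comp hH, fun t => (congrArg k (hpt t)).trans k.map_pt,
    fun x => congrArg k (h₀ x), fun x => congrArg k (h₁ x)⟩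

theorem Homotopic.comp_right {f g : Hom Y Z} (h : Homotopic f g) (k : Hom X Y) :
    Homotopic (f.comp k) (g.comp k) := by
  obtain ⟨H, hH, hpt, h₀, h₁⟩ := h
  exact ⟨fun p => H (p.1, k p.2), hH.comp (by fun_prop),
    fun t => (congrArg (fun y => H (t, y)) k.map_pt).trans (hpt t),
    fun x => h₀ (k x), fun x => h₁ (k x)⟩

end Homotopic

section MapSpace

variable {S : PointedFrl.{u}} {Y : PointedFrl.{v}} {W : PointedFrl.{w}}

/-- The point `s ∧ y` of the smash product. -/
def smashMk (s : S) (y : Y) : smash S Y := Quot.mk _ (s, y)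

@[fun_prop]
theorem smooth_smashMk : FrlSmooth fun p : S × Y => smashMk p.1 p.2 :=
  FrlSmooth.quotMk _

theorem smashMk_pt_left (y : Y) : smashMk S.pt y = (smash S Y).pt :=
  Quot.sound ⟨Or.inl rfl, Or.inl rfl⟩

theorem smashMk_pt_right (s : S) : smashMk s Y.pt = (smash S Y).pt :=
  Quot.sound ⟨Or.inr rfl, Or.inl rfl⟩

/-- The space of pointed maps, with the structure generated by the curves whose adjoint
`ℝ × S → W` is smooth. -/
def mapSpace (S : PointedFrl.{u}) (W : PointedFrl.{w}) : PointedFrl.{max u w} where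
  carrier := Hom S W
  str := ofCurves {c | FrlSmooth fun p : ℝ × S => c p.1 p.2}
  pt := Hom.trivial S W

theorem smooth_eval_mapSpace : FrlSmooth fun p : S × mapSpace S W => Hom.toFun p.2 p.1 := by
  refine FrlSmooth.of_generating
    (C₀ := {c : ℝ → mapSpace S W | FrlSmooth fun p : ℝ × S => Hom.toFun (c p.1) p.2})
    (fun f => ⟨fun _ => f, (Hom.smooth f).comp FrlSmooth.snd, 0, rfl⟩) (fun _ hf => hf)
    fun _ hc => ?_
  exact FrlSmooth.comp hc (FrlSmooth.snd.prodMk FrlSmooth.fst)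

theorem smooth_toMapSpace {Z : Type x} [FrolicherSpace Z] {φ : Z → mapSpace S W}
    (hφ : FrlSmooth fun p : Z × S => Hom.toFun (φ p.1) p.2) : FrlSmooth φ :=
  FrlSmooth.iff_curves.2 fun _ hc _ hf =>
    hf _ (hφ.comp (((FrlSmooth.of_mem_curves hc).comp FrlSmooth.fst).prodMk FrlSmooth.snd))

/-- The adjunction between `S ∧ -` and the space of pointed maps out of `S`. -/
def smashEquiv : Hom (smash S Y) W ≃ Hom Y (mapSpace S W) where
  toFun h :=
    { toFun := fun y =>
        { toFun := fun s => h (smashMk s y)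
          smooth := by fun_prop
          map_pt := by rw [smashMk_pt_left, h.map_pt] }
      smooth := smooth_toMapSpace (by fun_prop)
      map_pt := Hom.ext <| funext fun s => by
        change h (smashMk s Y.pt) = W.pt
        rw [smashMk_pt_right, h.map_pt] }
  invFun φ :=
    { toFun := Quot.lift (fun p : S × Y => Hom.toFun (φ p.2) p.1) (by
        have hpt (p : S × Y) (hp : p.1 = S.pt ∨ p.2 = Y.pt) : Hom.toFun (φ p.2) p.1 = W.pt := by
          rcases hp with hp | hp
          · exact (congrArg (Hom.toFun (φ p.2)) hp).trans (Hom.map_pt (φ p.2))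
          · exact congrArg (fun h => Hom.toFun h p.1) ((congrArg φ hp).trans φ.map_pt)
        exact fun p q h => (hpt p h.1).trans (hpt q h.2).symm)
      smooth := FrlSmooth.quotLift
        (smooth_eval_mapSpace.comp (FrlSmooth.fst.prodMk (φ.smooth.comp FrlSmooth.snd))) _
      map_pt := Hom.map_pt (φ Y.pt) }
  left_inv h := Hom.ext <| funext <| by rintro ⟨s, y⟩; rfl
  right_inv φ := rfl

theorem homotopic_smashEquiv_iff {f g : Hom (smash S Y) W} :
    Homotopic (smashEquiv f) (smashEquiv g) ↔ Homotopic f g := by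
  constructor
  · rintro ⟨H, hH, hpt, h₀, h₁⟩
    let γ (t : unitInterval) : Hom Y (mapSpace S W) :=
      ⟨fun y => H (t, y), hH.comp ((FrlSmooth.const t).prodMk FrlSmooth.id), hpt t⟩
    have hγ : FrlSmooth fun p : unitInterval × (S × Y) => Hom.toFun (H (p.1, p.2.2)) p.2.1 :=
      smooth_eval_mapSpace.comp (φ := fun p : unitInterval × (S × Y) => (p.2.1, H (p.1, p.2.2)))
        (by fun_prop)
    refine ⟨fun p => smashEquiv.symm (γ p.1) p.2, FrlSmooth.of_prod_quot hγ,
      fun t => Hom.map_pt _, fun z => ?_, fun z => ?_⟩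
    · have hγ₀ : γ 0 = smashEquiv f := Hom.ext (funext h₀)
      change smashEquiv.symm (γ 0) z = f z
      rw [hγ₀, Equiv.symm_apply_apply]
    · have hγ₁ : γ 1 = smashEquiv g := Hom.ext (funext h₁)
      change smashEquiv.symm (γ 1) z = g z
      rw [hγ₁, Equiv.symm_apply_apply]
  · rintro ⟨H, hH, hpt, h₀, h₁⟩
    let γ (t : unitInterval) : Hom (smash S Y) W :=
      ⟨fun z => H (t, z), hH.comp ((FrlSmooth.const t).prodMk FrlSmooth.id), hpt t⟩
    refine ⟨fun p => smashEquiv (γ p.1) p.2, smooth_toMapSpace ?_,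
      fun t => Hom.map_pt _, fun y => ?_, fun y => ?_⟩
    · exact hH.comp (φ := fun p : (unitInterval × Y) × S => (p.1.1, smashMk p.2 p.1.2))
        (by fun_prop)
    · exact congrArg (fun h => smashEquiv h y) (Hom.ext (funext h₀) : γ 0 = f)
    · exact congrArg (fun h => smashEquiv h y) (Hom.ext (funext h₁) : γ 1 = g)

end MapSpace

section Exactness

variable {X Y Z : PointedFrl.{u}} {g : Hom X Y} {f : Hom Y Z}

theorem exactAt_pullback_iff {W : PointedFrl.{v}} :
    Pointed.ExactAt (f.pullback W) (g.pullback W) ↔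
      ∀ h : Hom Y W, (∃ h' : Hom Z W, Homotopic (h'.comp f) h) ↔
        Homotopic (h.comp g) (Hom.trivial X W) := by
  refine Set.ext_iff.trans <| Quotient.mk_surjective.forall.trans <| forall_congr' fun h =>
    iff_congr (Quotient.mk_surjective.exists.trans <| exists_congr fun h' => ?_) ?_
  · exact Quotient.eq (r := homotopySetoid Y W)
  · exact Quotient.eq (r := homotopySetoid X W)

theorem exactAt_pullback {W : PointedFrl.{v}} (hfg : Homotopic (f.comp g) (Hom.trivial X Z))
    (hlift : ∀ h : Hom Y W, Homotopic (h.comp g) (Hom.trivial X W) →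
      ∃ h' : Hom Z W, Homotopic (h'.comp f) h) :
    Pointed.ExactAt (f.pullback W) (g.pullback W) := by
  refine exactAt_pullback_iff.2 fun h => ⟨?_, hlift h⟩
  rintro ⟨h', hh'⟩
  have htrivial : h'.comp (Hom.trivial X Z) = Hom.trivial X W := Hom.ext (funext fun _ => h'.map_pt)
  exact htrivial ▸ (hh'.symm.comp_right g).trans (hfg.comp_left h')

/-- Suspension is left adjoint to the loop space functor, so exactness for the target
`mapSpace flatCircle W` gives exactness of the suspended sequence for the target `W`. -/
theorem exactAt_pullback_susp
    (h : ∀ W : PointedFrl.{v}, Pointed.ExactAt (f.pullback W) (g.pullback W))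
    (W : PointedFrl.{v}) : Pointed.ExactAt (f.susp.pullback W) (g.susp.pullback W) := by
  refine exactAt_pullback_iff.2 fun k => ?_
  have hloop := exactAt_pullback_iff.1 (h (mapSpace flatCircle W)) (smashEquiv k)
  rw [smashEquiv.surjective.exists] at hloop
  refine (exists_congr fun k' => ?_).trans (hloop.trans ?_)
  · exact (homotopic_smashEquiv_iff (f := k'.comp f.susp)).symm
  · exact homotopic_smashEquiv_iff (f := k.comp g.susp) (g := Hom.trivial _ W)

theorem exactAt_pullback_iterSusp (n : ℕ) {X Y Z : PointedFrl.{u}} {g : Hom X Y} {f : Hom Y Z}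
    (h : ∀ W : PointedFrl.{v}, Pointed.ExactAt (f.pullback W) (g.pullback W))
    (W : PointedFrl.{v}) :
    Pointed.ExactAt ((f.iterSusp n).pullback W) ((g.iterSusp n).pullback W) := by
  induction n generalizing X Y Z with
  | zero => exact h W
  | succ _ ih => exact ih (exactAt_pullback_susp h)

end Exactness

end PointedFrl

namespace PointedFrl

open FlatInterval unitInterval

section Susp

variable {A : PointedFrl.{u}} {W : PointedFrl.{v}}

/-- The condition for a map on `𝐈 × A` to factor through the suspension of `A`. -/
structure DescendsToSusp (φ : FlatInterval → A → W) : Prop where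
  map_zero : ∀ a, φ zero a = W.pt
  map_one : ∀ a, φ one a = W.pt
  map_pt : ∀ t, φ t A.pt = W.pt

theorem DescendsToSusp.eq_of_endpoints {φ : FlatInterval → A → W} (h : DescendsToSusp φ) (a : A)
    {t t' : FlatInterval} (ht : (t = zero ∨ t = one) ∧ (t' = zero ∨ t' = one)) :
    φ t a = φ t' a := by
  obtain ⟨rfl | rfl, rfl | rfl⟩ := ht <;> simp only [h.map_zero, h.map_one]

/-- The map on the suspension of `A` induced by a map on `𝐈 × A`. -/
def suspLift {φ : FlatInterval → A → W} (h : DescendsToSusp φ) : susp A → W :=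
  Quot.lift
    (fun p => Quot.lift (fun t => φ t p.2) (fun _ _ => h.eq_of_endpoints p.2) p.1)
    (by
      have hbase {t : FlatInterval} {a : A}
          (hp : (Quot.mk _ t : flatCircle) = flatCircle.pt ∨ a = A.pt) : φ t a = W.pt := by
        rcases hp with hp | rfl
        · exact (congrArg (Quot.lift (φ · a) fun _ _ => h.eq_of_endpoints a) hp).trans
            (h.map_zero a)
        · exact h.map_pt t
      rintro ⟨⟨t⟩, a⟩ ⟨⟨t'⟩, a'⟩ hp
      exact (hbase hp.1).trans (hbase hp.2).symm)

theorem smooth_suspLift {Z : Type w} [FrolicherSpace Z] {φ : Z → FlatInterval → A → W}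
    (h : ∀ z, DescendsToSusp (φ z))
    (hφ : FrlSmooth fun p : Z × (FlatInterval × A) => φ p.1 p.2.1 p.2.2) :
    FrlSmooth fun p : Z × susp A => suspLift (h p.1) p.2 := by
  refine FrlSmooth.of_prod_quot ?_
  have hcircle : FrlSmooth fun p : (Z × A) × flatCircle =>
      suspLift (h p.1.1) (smashMk p.2 p.1.2) :=
    FrlSmooth.of_prod_quot <|
      hφ.comp (φ := fun p : (Z × A) × FlatInterval => (p.1.1, (p.2, p.1.2))) (by fun_prop)
  exact hcircle.comp (φ := fun p : Z × (flatCircle × A) => ((p.1, p.2.2), p.2.1)) (by fun_prop)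

/-- The pointed map on the suspension of `A` induced by a smooth map on `𝐈 × A`. -/
def Hom.ofSusp {φ : FlatInterval → A → W} (h : DescendsToSusp φ)
    (hφ : FrlSmooth fun p : FlatInterval × A => φ p.1 p.2) : Hom (PointedFrl.susp A) W where
  toFun := suspLift h
  smooth := (smooth_suspLift (fun _ : unitInterval => h) (hφ.comp FrlSmooth.snd)).comp
    ((FrlSmooth.const 0).prodMk FrlSmooth.id)
  map_pt := h.map_zero A.pt

theorem forall_susp {p : susp A → Prop} : (∀ y, p y) ↔ ∀ t a, p (suspMk t a) :=
  ⟨fun h _ _ => h _, fun h => by rintro ⟨⟨t⟩, a⟩; exact h t a⟩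

theorem Homotopic.of_susp {f g : Hom (susp A) W} {φ : unitInterval → FlatInterval → A → W}
    (h : ∀ s, DescendsToSusp (φ s))
    (hφ : FrlSmooth fun p : unitInterval × (FlatInterval × A) => φ p.1 p.2.1 p.2.2)
    (hf : ∀ t a, φ 0 t a = f (suspMk t a)) (hg : ∀ t a, φ 1 t a = g (suspMk t a)) :
    Homotopic f g :=
  ⟨fun p => suspLift (h p.1) p.2, smooth_suspLift h hφ, fun s => (h s).map_zero A.pt,
    forall_susp.2 hf, forall_susp.2 hg⟩

theorem Homotopic.of_susp_brake {f g : Hom (susp A) W} {φ : unitInterval → FlatInterval → A → W}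
    {a b : ℝ} (ha : 0 < a) (hab : a < b) (hb : b < 1) (h : ∀ s, DescendsToSusp (φ s))
    (hφ : FrlSmooth fun p : unitInterval × (FlatInterval × A) => φ p.1 p.2.1 p.2.2)
    (hf : ∀ t x, φ 0 t x = f (suspMk (ofUnit (brake a b t)) x))
    (hg : ∀ t x, φ 1 t x = g (suspMk t x)) : Homotopic f g := by
  let m : Hom (susp A) W := Hom.ofSusp (h 0) (hφ.comp ((FrlSmooth.const 0).prodMk FrlSmooth.id))
  have hmg : Homotopic m g := Homotopic.of_susp h hφ (fun _ _ => rfl) hg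
  refine Homotopic.trans (g := m) (Homotopic.of_susp
    (φ := fun s t x => f (suspMk (brakeHomotopy a b s t) x)) (fun s => ⟨fun x => ?_, fun x => ?_,
      fun t => ?_⟩) ?_ (fun t x => ?_) fun t x => ?_) hmg
  · rw [brakeHomotopy_zero ha hab, suspMk_eq_pt (Or.inl rfl), f.map_pt]
  · rw [brakeHomotopy_one hab hb, suspMk_eq_pt (Or.inr (Or.inl rfl)), f.map_pt]
  · rw [suspMk_eq_pt (Or.inr (Or.inr rfl)), f.map_pt]
  · fun_prop (disch := assumption)
  · rw [brakeHomotopy_zero_left]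
  · rw [brakeHomotopy_one_left]
    exact (hf t x).symm

end Susp

section Cone

variable {A X : PointedFrl.{u}} {i : Hom A X} {W : PointedFrl.{v}}

/-- The point `[t, a]` of the flattened mapping cone. -/
def coneMk (i : Hom A X) (t : FlatInterval) (a : A) : flatCone i :=
  Quot.mk _ (Quot.mk _ (Sum.inl (t, a)))

@[fun_prop]
theorem smooth_coneMk : FrlSmooth fun p : FlatInterval × A => coneMk i p.1 p.2 :=
  (FrlSmooth.quotMk _).comp ((FrlSmooth.quotMk _).comp FrlSmooth.inl)

theorem coneMk_zero (a : A) : coneMk i zero a = (flatCone i).pt :=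
  Quot.sound ⟨⟨zero, a, Or.inl rfl, rfl⟩, ⟨zero, A.pt, Or.inl rfl, rfl⟩⟩

theorem coneMk_one (a : A) : coneMk i one a = coneIncl i (i a) :=
  congrArg (Quot.mk _) (Quot.sound ⟨a, rfl, rfl⟩)

theorem coneMk_pt (t : FlatInterval) : coneMk i t A.pt = (flatCone i).pt :=
  Quot.sound ⟨⟨t, A.pt, Or.inr rfl, rfl⟩, ⟨zero, A.pt, Or.inl rfl, rfl⟩⟩

/-- The condition for maps on `𝐈 × A` and on `X` to factor through the flattened mapping cone. -/
structure DescendsToCone (i : Hom A X) (φ : FlatInterval → A → W) (ψ : X → W) : Prop where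
  map_zero : ∀ a, φ zero a = W.pt
  map_one : ∀ a, φ one a = ψ (i a)
  map_pt : ∀ t, φ t A.pt = W.pt

/-- The map on the flattened mapping cylinder induced by maps on `𝐈 × A` and on `X`. -/
def cylinderLift {φ : FlatInterval → A → W} {ψ : X → W} (h : DescendsToCone i φ ψ) :
    FlatCylinder i → W :=
  Quot.lift (Sum.elim (fun p => φ p.1 p.2) ψ) (by
    rintro _ _ ⟨a, rfl, rfl⟩
    exact h.map_one a)

theorem cylinderLift_eq_pt {φ : FlatInterval → A → W} {ψ : X → W} (h : DescendsToCone i φ ψ)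
    {z : FlatCylinder i} (hz : z ∈ flatConeBase i) : cylinderLift h z = W.pt := by
  obtain ⟨t, a, rfl | rfl, rfl⟩ := hz
  exacts [h.map_zero a, h.map_pt t]

/-- The map on the flattened mapping cone induced by maps on `𝐈 × A` and on `X`. -/
def coneLift {φ : FlatInterval → A → W} {ψ : X → W} (h : DescendsToCone i φ ψ) :
    flatCone i → W :=
  Quot.lift (cylinderLift h) fun _ _ hz =>
    (cylinderLift_eq_pt h hz.1).trans (cylinderLift_eq_pt h hz.2).symm

theorem smooth_coneLift {Z : Type w} [FrolicherSpace Z] {φ : Z → FlatInterval → A → W}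
    {ψ : Z → X → W} (h : ∀ z, DescendsToCone i (φ z) (ψ z))
    (hφ : FrlSmooth fun p : Z × (FlatInterval × A) => φ p.1 p.2.1 p.2.2)
    (hψ : FrlSmooth fun p : Z × X => ψ p.1 p.2) :
    FrlSmooth fun p : Z × flatCone i => coneLift (h p.1) p.2 :=
  FrlSmooth.of_prod_quot (FrlSmooth.of_prod_quot (FrlSmooth.of_prod_sum hφ hψ))

/-- The pointed map on the flattened mapping cone induced by smooth maps on `𝐈 × A` and on
`X`. -/
def Hom.ofCone {φ : FlatInterval → A → W} {ψ : X → W} (h : DescendsToCone i φ ψ)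
    (hφ : FrlSmooth fun p : FlatInterval × A => φ p.1 p.2) (hψ : FrlSmooth ψ) :
    Hom (flatCone i) W where
  toFun := coneLift h
  smooth := (smooth_coneLift (fun _ : unitInterval => h) (hφ.comp FrlSmooth.snd)
    (hψ.comp FrlSmooth.snd)).comp ((FrlSmooth.const 0).prodMk FrlSmooth.id)
  map_pt := h.map_zero A.pt

theorem forall_cone {p : flatCone i → Prop} :
    (∀ y, p y) ↔ (∀ t a, p (coneMk i t a)) ∧ ∀ x, p (coneIncl i x) :=
  ⟨fun h => ⟨fun _ _ => h _, fun _ => h _⟩, fun h => by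
    rintro ⟨⟨⟨t, a⟩ | x⟩⟩
    exacts [h.1 t a, h.2 x]⟩

theorem Homotopic.of_cone {f g : Hom (flatCone i) W} {φ : unitInterval → FlatInterval → A → W}
    {ψ : unitInterval → X → W} (h : ∀ s, DescendsToCone i (φ s) (ψ s))
    (hφ : FrlSmooth fun p : unitInterval × (FlatInterval × A) => φ p.1 p.2.1 p.2.2)
    (hψ : FrlSmooth fun p : unitInterval × X => ψ p.1 p.2)
    (hf : ∀ t a, φ 0 t a = f (coneMk i t a)) (hf' : ∀ x, ψ 0 x = f (coneIncl i x))
    (hg : ∀ t a, φ 1 t a = g (coneMk i t a)) (hg' : ∀ x, ψ 1 x = g (coneIncl i x)) :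
    Homotopic f g :=
  ⟨fun p => coneLift (h p.1) p.2, smooth_coneLift h hφ hψ, fun s => (h s).map_zero A.pt,
    forall_cone.2 ⟨hf, hf'⟩, forall_cone.2 ⟨hg, hg'⟩⟩

theorem Homotopic.of_cone_brake {f g : Hom (flatCone i) W}
    {φ : unitInterval → FlatInterval → A → W} {ψ : unitInterval → X → W} {a b : ℝ}
    (ha : 0 < a) (hab : a < b) (hb : b < 1) (h : ∀ s, DescendsToCone i (φ s) (ψ s))
    (hφ : FrlSmooth fun p : unitInterval × (FlatInterval × A) => φ p.1 p.2.1 p.2.2)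
    (hψ : FrlSmooth fun p : unitInterval × X => ψ p.1 p.2)
    (hf : ∀ t x, φ 0 t x = f (coneMk i (ofUnit (brake a b t)) x))
    (hf' : ∀ x, ψ 0 x = f (coneIncl i x))
    (hg : ∀ t x, φ 1 t x = g (coneMk i t x)) (hg' : ∀ x, ψ 1 x = g (coneIncl i x)) :
    Homotopic f g := by
  let m : Hom (flatCone i) W :=
    Hom.ofCone (h 0) (hφ.comp ((FrlSmooth.const 0).prodMk FrlSmooth.id))
      (hψ.comp ((FrlSmooth.const 0).prodMk FrlSmooth.id))
  have hmg : Homotopic m g :=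
    Homotopic.of_cone h hφ hψ (fun _ _ => rfl) (fun _ => rfl) hg hg'
  refine Homotopic.trans (g := m) (Homotopic.of_cone
    (φ := fun s t x => f (coneMk i (brakeHomotopy a b s t) x)) (ψ := fun _ x => f (coneIncl i x))
    (fun s => ⟨fun x => ?_, fun x => ?_, fun t => ?_⟩) ?_ ?_ (fun t x => ?_) (fun _ => rfl)
    (fun t x => ?_) fun x => ?_) hmg
  · rw [brakeHomotopy_zero ha hab, coneMk_zero, f.map_pt]
  · rw [brakeHomotopy_one hab hb, coneMk_one]
  · rw [coneMk_pt, f.map_pt]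
  · fun_prop (disch := assumption)
  · exact f.smooth.comp ((coneIncl i).smooth.comp FrlSmooth.snd)
  · rw [brakeHomotopy_zero_left]
  · rw [brakeHomotopy_one_left]
    exact (hf t x).symm
  · exact (hf' x).symm

end Cone

end PointedFrl

namespace PointedFrl

open FlatInterval unitInterval

section PuppeSequence

variable {A X : PointedFrl.{u}} {W : PointedFrl.{v}}

theorem coneIncl_comp_homotopic_trivial (i : Hom A X) :
    Homotopic ((coneIncl i).comp i) (Hom.trivial A (flatCone i)) := by
  refine ⟨fun p => coneMk i (ofUnit (σ p.1)) p.2, by fun_prop, fun s => coneMk_pt _,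
    fun a => ?_, fun a => ?_⟩
  · simp only [symm_zero, ofUnit_one, coneMk_one]
    rfl
  · simp only [symm_one, ofUnit_zero, coneMk_zero]
    rfl

theorem exists_comp_coneIncl_eq {i : Hom A X} {h : Hom X W}
    (hi : Homotopic (h.comp i) (Hom.trivial A W)) :
    ∃ h' : Hom (flatCone i) W, h'.comp (coneIncl i) = h := by
  obtain ⟨N, hN, hpt, h₀, h₁⟩ := hi.symm
  have hd : DescendsToCone i (fun t a => N (brake (1 / 4) (3 / 4) t, a)) h :=
    { map_zero := fun a => by rw [brake_zero (by norm_num) (by norm_num), h₀]; rfl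
      map_one := fun a => by rw [brake_one (by norm_num) (by norm_num), h₁]; rfl
      map_pt := fun t => hpt _ }
  exact ⟨Hom.ofCone hd (hN.comp (by fun_prop (disch := norm_num))) h.smooth, rfl⟩

/-- The homotopy of `X` is attached to the upper half of the cone, and `h` is compressed into the
lower half. -/
theorem exists_homotopic_comp_coneIncl_eq {i : Hom A X} {h : Hom (flatCone i) W} {k : Hom X W}
    (hk : Homotopic (h.comp (coneIncl i)) k) :
    ∃ g : Hom (flatCone i) W, Homotopic h g ∧ g.comp (coneIncl i) = k := by
  obtain ⟨N, hN, hpt, h₀, h₁⟩ := hk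
  let φ (s : unitInterval) (t : FlatInterval) (a : A) : W :=
    if (toUnit t : ℝ) ≤ 1 / 2 then h (coneMk i (ofUnit (brake (1 / 8) (3 / 8) t)) a)
    else N (s * brake (5 / 8) (7 / 8) t, i a)
  have hjoin {t : FlatInterval} (ht : 3 / 8 ≤ (toUnit t : ℝ)) (a : A) :
      h (coneMk i (ofUnit (brake (1 / 8) (3 / 8) t)) a) = N (0, i a) := by
    rw [brake_eq_one (by norm_num) ht, ofUnit_one, coneMk_one, h₀]
    rfl
  have hd (s : unitInterval) : DescendsToCone i (φ s) fun x => N (s, x) :=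
    { map_zero := fun a => (if_pos (by norm_num)).trans <| by
        rw [brake_zero (by norm_num) (by norm_num), ofUnit_zero, coneMk_zero, h.map_pt]
      map_one := fun a => (if_neg (by norm_num)).trans <| by
        rw [brake_one (by norm_num) (by norm_num), mul_one]
      map_pt := fun t => by simp only [φ, coneMk_pt, h.map_pt, i.map_pt, hpt, ite_self] }
  have hφ : FrlSmooth fun p : unitInterval × (FlatInterval × A) => φ p.1 p.2.1 p.2.2 := by
    refine smooth_ite (a := 3 / 8) (b := 5 / 8) (FrlSmooth.fst.comp FrlSmooth.snd)
      (by fun_prop (disch := norm_num)) (hN.comp (by fun_prop (disch := norm_num)))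
      (by norm_num) (by norm_num) (by norm_num) (by norm_num) fun p hp hp' => ?_
    rw [hjoin hp, brake_eq_zero (by norm_num) hp', mul_zero]
  refine ⟨Hom.ofCone (hd 1) (hφ.comp ((FrlSmooth.const 1).prodMk FrlSmooth.id))
    (hN.comp ((FrlSmooth.const 1).prodMk FrlSmooth.id)), ?_, Hom.ext (funext h₁)⟩
  refine Homotopic.of_cone_brake (a := 1 / 8) (b := 3 / 8) (by norm_num) (by norm_num)
    (by norm_num) hd hφ hN (fun t a => ?_) h₀ (fun _ _ => rfl) fun _ => rfl
  simp only [φ, zero_mul]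
  split_ifs with ht
  · rfl
  · exact (hjoin (by linarith) a).symm

theorem exists_comp_coneQuot_eq {i : Hom A X} {g : Hom (flatCone i) W}
    (hg : g.comp (coneIncl i) = Hom.trivial X W) :
    ∃ h' : Hom (susp A) W, h'.comp (coneQuot i) = g := by
  have hgx (x : X) : g (coneIncl i x) = W.pt := congrArg (fun k : Hom X W => k x) hg
  have hd : DescendsToSusp fun t a => g (coneMk i t a) :=
    { map_zero := fun a => by rw [coneMk_zero, g.map_pt]
      map_one := fun a => by rw [coneMk_one, hgx]
      map_pt := fun t => by rw [coneMk_pt, g.map_pt] }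
  exact ⟨Hom.ofSusp hd (by fun_prop), Hom.ext <| funext <|
    forall_cone.2 ⟨fun _ _ => rfl, fun x => (Hom.map_pt _).trans (hgx x).symm⟩⟩

theorem susp_comp_coneQuot_homotopic_trivial (i : Hom A X) :
    Homotopic (i.susp.comp (coneQuot i)) (Hom.trivial (flatCone i) (susp X)) := by
  have hd (s : unitInterval) : DescendsToCone i
      (fun t a => suspMk (ofUnit (σ s * brake (1 / 4) (3 / 4) t)) (i a))
      fun x => suspMk (ofUnit (σ s)) x :=
    { map_zero := fun a => by
        rw [brake_zero (by norm_num) (by norm_num), mul_zero]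
        exact suspMk_eq_pt (Or.inl rfl)
      map_one := fun a => by rw [brake_one (by norm_num) (by norm_num), mul_one]
      map_pt := fun t => suspMk_eq_pt (Or.inr (Or.inr i.map_pt)) }
  refine Homotopic.of_cone_brake (a := 1 / 4) (b := 3 / 4) (by norm_num) (by norm_num)
    (by norm_num) hd (by fun_prop (disch := norm_num)) (by fun_prop) (fun t a => ?_) (fun x => ?_)
    (fun t a => ?_) fun x => ?_
  · rw [symm_zero, one_mul]
    rfl
  · rw [symm_zero]
    exact (suspMk_eq_pt (Or.inr (Or.inl rfl))).trans i.susp.map_pt.symm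
  · rw [symm_one, zero_mul]
    exact suspMk_eq_pt (Or.inl rfl)
  · rw [symm_one]
    exact suspMk_eq_pt (Or.inl rfl)

/-- In the cone coordinate, a homotopy on `𝐓_i` is a map on the square of pairs `(s, t)`. For a null
homotopy of a map trivial on `X`, the edges `s = 1` and `t = 0` and the corner `(0, 1)` go to the
basepoint, so a path from these edges to this corner gives a map on the suspension. -/
theorem descendsToSusp_of_path {i : Hom A X} {N : unitInterval × flatCone i → W}
    (hpt : ∀ s, N (s, (flatCone i).pt) = W.pt) (hN₀ : ∀ x, N (0, coneIncl i x) = W.pt)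
    (hN₁ : ∀ y, N (1, y) = W.pt) {u v : FlatInterval → unitInterval}
    (hzero : u zero = 1 ∨ v zero = 0) (hone : u one = 0 ∧ v one = 1) :
    DescendsToSusp fun t a => N (u t, coneMk i (ofUnit (v t)) a) where
  map_zero a := by
    rcases hzero with hu | hv
    · rw [hu, hN₁]
    · rw [hv, ofUnit_zero, coneMk_zero, hpt]
  map_one a := by rw [hone.1, hone.2, ofUnit_one, coneMk_one, hN₀]
  map_pt t := by rw [coneMk_pt, hpt]

/-- The path along the edge `s = 0` of the square, which gives `h`, is deformed to the path along
the edge `t = 1`, which gives a map that factors through `Σ X`. -/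
theorem exists_comp_susp_homotopic {i : Hom A X} {h : Hom (susp A) W}
    (hk : Homotopic (h.comp (coneQuot i)) (Hom.trivial (flatCone i) W)) :
    ∃ h' : Hom (susp X) W, Homotopic (h'.comp i.susp) h := by
  obtain ⟨N, hN, hpt, hN₀, hN₁⟩ := hk
  have hNX (x : X) : N (0, coneIncl i x) = W.pt := (hN₀ _).trans h.map_pt
  let β : FlatInterval → unitInterval := brake (1 / 4) (3 / 4)
  have hβ : FrlSmooth β := smooth_brake (by norm_num) (by norm_num) (by norm_num)
  have hβ₀ : β zero = 0 := brake_zero (by norm_num) (by norm_num)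
  have hβ₁ : β one = 1 := brake_one (by norm_num) (by norm_num)
  have hd : DescendsToSusp fun t x => N (σ (β t), coneIncl i x) :=
    { map_zero := fun x => by rw [hβ₀, symm_zero, hN₁]; rfl
      map_one := fun x => by rw [hβ₁, symm_one, hNX]
      map_pt := fun t => by rw [(coneIncl i).map_pt, hpt] }
  have hd' (s : unitInterval) : DescendsToSusp fun t a =>
      N (σ (β t) * smoothStep 0 (1 / 2) s,
        coneMk i (ofUnit (Set.Icc.convexComb (β t) 1 (smoothStep (1 / 2) 1 s))) a) := by
    refine descendsToSusp_of_path hpt hNX hN₁ ?_ ⟨?_, ?_⟩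
    · rw [hβ₀, symm_zero, one_mul]
      rcases le_total (s : ℝ) (1 / 2) with hs | hs
      · exact Or.inr <| by
          rw [smoothStep_eq_zero (by norm_num) hs, Set.Icc.convexComb_zero]
      · exact Or.inl (smoothStep_eq_one (by norm_num) hs)
    · rw [hβ₁, symm_one, zero_mul]
    · rw [hβ₁, Set.Icc.convexComb_eq]
  refine ⟨Hom.ofSusp hd (hN.comp ?_), (Homotopic.of_susp_brake (a := 1 / 4) (b := 3 / 4)
    (by norm_num) (by norm_num) (by norm_num) hd' (hN.comp (by fun_prop)) (fun t a => ?_)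
    fun t a => ?_).symm⟩
  · exact (FrlSmooth.symm.comp (hβ.comp FrlSmooth.fst)).prodMk
      ((coneIncl i).smooth.comp FrlSmooth.snd)
  · rw [smoothStep_zero le_rfl (by norm_num), smoothStep_zero (by norm_num) (by norm_num),
      mul_zero, Set.Icc.convexComb_zero]
    exact hN₀ _
  · rw [smoothStep_one (by norm_num) (by norm_num), smoothStep_one (by norm_num) le_rfl, mul_one,
      Set.Icc.convexComb_one, ofUnit_one, coneMk_one]
    rfl

theorem exactAt_pullback_coneIncl (i : Hom A X) (W : PointedFrl.{v}) :
    Pointed.ExactAt ((coneIncl i).pullback W) (i.pullback W) :=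
  exactAt_pullback (coneIncl_comp_homotopic_trivial i) fun _ hh =>
    (exists_comp_coneIncl_eq hh).imp <| by
      rintro h' rfl
      exact Homotopic.refl _

theorem exactAt_pullback_coneQuot (i : Hom A X) (W : PointedFrl.{v}) :
    Pointed.ExactAt ((coneQuot i).pullback W) ((coneIncl i).pullback W) := by
  refine exactAt_pullback (Homotopic.refl _) fun h hh => ?_
  obtain ⟨g, hhg, hg⟩ := exists_homotopic_comp_coneIncl_eq hh
  obtain ⟨h', rfl⟩ := exists_comp_coneQuot_eq hg
  exact ⟨h', hhg.symm⟩

theorem exactAt_pullback_susp_coneQuot (i : Hom A X) (W : PointedFrl.{v}) :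
    Pointed.ExactAt (i.susp.pullback W) ((coneQuot i).pullback W) :=
  exactAt_pullback (susp_comp_coneQuot_homotopic_trivial i) fun _ => exists_comp_susp_homotopic

end PuppeSequence

end PointedFrl

theorem theorem541_general {A X : PointedFrl.{u}} (i : PointedFrl.Hom A X) (W : PointedFrl.{v})
    (n : ℕ) :
    Pointed.ExactAt (((PointedFrl.coneIncl i).iterSusp n).pullback W)
        ((i.iterSusp n).pullback W) ∧
    Pointed.ExactAt (((PointedFrl.coneQuot i).iterSusp n).pullback W)
        (((PointedFrl.coneIncl i).iterSusp n).pullback W) ∧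
    Pointed.ExactAt ((i.iterSusp (n + 1)).pullback W)
        (((PointedFrl.coneQuot i).iterSusp n).pullback W) := by
  have hX := PointedFrl.exactAt_pullback_iterSusp n (PointedFrl.exactAt_pullback_coneIncl i) W
  have hT := PointedFrl.exactAt_pullback_iterSusp n (PointedFrl.exactAt_pullback_coneQuot i) W
  have hA := PointedFrl.exactAt_pullback_iterSusp n (PointedFrl.exactAt_pullback_susp_coneQuot i) W
  exact ⟨hX, hT, hA⟩

theorem theorem541 {A X : PointedFrl.{u}} (i : PointedFrl.Hom A X)
    (hi : PointedFrl.IsCofibration i) (W : PointedFrl.{u}) (n : ℕ) :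
    -- exactness at `[Σⁿ X, W]`
    Pointed.ExactAt (((PointedFrl.coneIncl i).iterSusp n).pullback W)
        ((i.iterSusp n).pullback W) ∧
    -- exactness at `[Σⁿ 𝐓_i, W]`
    Pointed.ExactAt (((PointedFrl.coneQuot i).iterSusp n).pullback W)
        (((PointedFrl.coneIncl i).iterSusp n).pullback W) ∧
    -- exactness at `[Σⁿ⁺¹ A, W]`
    Pointed.ExactAt ((i.iterSusp (n + 1)).pullback W)
        (((PointedFrl.coneQuot i).iterSusp n).pullback W) :=
  theorem541_general i W n
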